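/- Let $\pi$ be a set of primes and $\pi'$ the complementary set of primes. For a finite group $H$, let $\mathrm{ccl}(H)$ be the number of conjugacy classes of $H$ and $\mathrm{Irr}(H)$ the set of irreducible complex characters of $H$. A Hall $\pi$-subgroup of $H$ is a subgroup whose order is divisible only by primes in $\pi$ and whose index is divisible by no prime in $\pi$. For a finite soluble group $H$, let $A$ denote a Hall $\pi$-subgroup and $B$ a Hall $\pi'$-subgroup of $H$. Say that - $H$ is $\mathrm{Con}_\pi$ if $\mathrm{ccl}(H)\le \mathrm{ccl}(A)\,\mathrm{ccl}(B)$; - $H$ is $\mathrm{Con}^*_\pi$ if $\mathrm{ccl}(H)<\mathrm{ccl}(A)\,\mathrm{ccl}(B)$ or $H\cong A\times B$; - $H$ is $\mathrm{SCon}_\pi$ if $H$ is $\mathrm{Con}_\pi$ and, for every central subgroup $M$ of $H$ of prime order $p$, $$\mathrm{ccl}(H)-\mathrm{ccl}(H/M)\le(\mathrm{ccl}(A)-\mathrm{ccl}(A/M))\,\mathrm{ccl}(B)\quad\text{if } p\in\pi,$$ $$\mathrm{ccl}(H)-\mathrm{ccl}(H/M)\le\mathrm{ccl}(A)\,(\mathrm{ccl}(B)-\mathrm{ccl}(B/M))\quad\text{if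 } p\in\pi'.$$ (By Hall's theorem these properties do not depend on the choice of $A$ and $B$.) Let $G$ be a finite soluble group and $N$ an elementary abelian normal subgroup of $G$. For $\nu\in\mathrm{Irr}(N)$ and a subgroup $K$ of $G$, let $K_\nu$ be the stabiliser of $\nu$ in $K$ under the conjugation action. Suppose that $G$ has balanced action on $\mathrm{Irr}(N)$, that is: for some $\sigma\in\{\pi,\pi'\}$ and some Hall $\sigma$-subgroup $S$ of $G$ containing $N$, the group $S_\nu$ is a Hall $\sigma$-subgroup of $G_\nu$ for every $\nu\in\mathrm{Irr}(N)$. Suppose that $G_\nu/N$ is $\mathrm{Con}_\pi$ for every $\nu\in\mathrm{Irr}(N)$, and that at least one of the following holds: (i) every $\nu\in\mathrm{Irr}(N)$ extends to a character of $G_\nu$; (ii) for every $\nu\in\mathrm{Irr}(N)$, the group $G_\nu/\ker\nu$ is $\mathrm{SCon}_\pi$. Then $G$ is $\mathrm{Con}_\pi$. If moreover $G/N$ is $\mathrm{Con}^*_\pi$, then $G$ is $\mathrm{Con}^*_\pi$. -/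

import Mathlib

namespace HallConj

/-- The number of conjugacy classes of `G`. -/
noncomputable def ccl (G : Type*) [Group G] : ℕ := Nat.card (ConjClasses G)

/-- `A` is a Hall `π`-subgroup of `G`: every prime dividing the order of `A` is in `π`, and no
prime dividing the index of `A` is in `π`. The complementary set of primes `π'` is `πᶜ`. -/
def IsHall {G : Type*} [Group G] (π : Set Nat.Primes) (A : Subgroup G) : Prop :=
  (∀ p : Nat.Primes, (p : ℕ) ∣ Nat.card A → p ∈ π) ∧ (∀ p : Nat.Primes, (p : ℕ) ∣ A.index → p ∉ π)

/-- `Con_π`: `ccl G ≤ ccl A * ccl B` for Hall `π`- and `π'`-subgroups `A` and `B` of `G`. -/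
def IsCon (π : Set Nat.Primes) (G : Type*) [Group G] : Prop :=
  ∀ A B : Subgroup G, IsHall π A → IsHall πᶜ B → ccl G ≤ ccl A * ccl B

/-- `Con*_π`: moreover the inequality is strict unless `G ≅ A × B`. -/
def IsConStar (π : Set Nat.Primes) (G : Type*) [Group G] : Prop :=
  ∀ A B : Subgroup G, IsHall π A → IsHall πᶜ B →
    (ccl G < ccl A * ccl B ∨ Nonempty (G ≃* (A × B)))

/-- `SCon_π`. The differences are taken in `ℤ`. A central subgroup of order `p ∈ π` lies in every
Hall `π`-subgroup `A`, so that `M.subgroupOf A` is `M` regarded as a subgroup of `A`. -/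
def IsSCon (π : Set Nat.Primes) (G : Type*) [Group G] : Prop :=
  IsCon π G ∧
  (∀ A B : Subgroup G, IsHall π A → IsHall πᶜ B →
    ∀ (M : Subgroup G) [M.Normal], M ≤ Subgroup.center G →
      (∃ p : Nat.Primes, p ∈ π ∧ Nat.card M = p) →
        (ccl G : ℤ) - ccl (G ⧸ M) ≤ ((ccl A : ℤ) - ccl (A ⧸ M.subgroupOf A)) * ccl B) ∧
  (∀ A B : Subgroup G, IsHall π A → IsHall πᶜ B →
    ∀ (M : Subgroup G) [M.Normal], M ≤ Subgroup.center G →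
      (∃ p : Nat.Primes, p ∉ π ∧ Nat.card M = p) →
        (ccl G : ℤ) - ccl (G ⧸ M) ≤ ccl A * ((ccl B : ℤ) - ccl (B ⧸ M.subgroupOf B)))

/-- `N` is an elementary abelian `p`-group for some prime `p`. -/
def IsElementaryAbelian {G : Type*} [Group G] (N : Subgroup G) : Prop :=
  ∃ p : Nat.Primes, (∀ x ∈ N, ∀ y ∈ N, x * y = y * x) ∧ ∀ x ∈ N, x ^ (p : ℕ) = 1

/-- `Irr(H)`: the set of characters of irreducible (finite-dimensional) complex representations
of `H`. -/
def Irr (H : Type*) [Group H] : Set (H → ℂ) :=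
  {χ | ∃ (n : ℕ) (ρ : Representation ℂ H (Fin n → ℂ)), ρ.IsIrreducible ∧ ρ.character = χ}

section

variable {G : Type*} [Group G] (N : Subgroup G) [N.Normal]

/-- The centraliser `G_ν` in `G` of `ν : N → ℂ` for the conjugation action of `G` on functions
on its normal subgroup `N`. -/
def stab (ν : N → ℂ) : Subgroup G where
  carrier := {g | ∀ k : N, ν (MulAut.conjNormal g k) = ν k}
  one_mem' := fun k => by simp
  mul_mem' := fun {a b} ha hb k => by
    have h := ha (MulAut.conjNormal b k)
    rw [map_mul, MulAut.mul_apply, h, hb k]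
  inv_mem' := fun {a} ha k => by
    have h := ha (MulAut.conjNormal a⁻¹ k)
    rw [map_inv, MulAut.apply_inv_self] at h
    rw [map_inv]
    exact h.symm

theorem mem_stab (ν : N → ℂ) (g : G) :
    g ∈ stab N ν ↔ ∀ k : N, ν (MulAut.conjNormal g k) = ν k := Iff.rfl

theorem le_stab {ν : N → ℂ} (hν : ν ∈ Irr N) : N ≤ stab N ν := by
  obtain ⟨n, ρ, -, rfl⟩ := hν
  intro g hg k
  have h : MulAut.conjNormal g k = (⟨g, hg⟩ : N) * k * (⟨g, hg⟩ : N)⁻¹ := by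
    ext; simp
  rw [h, Representation.char_conj]

/-- The kernel `{k | ν k = ν 1}` of `ν`, as a subgroup of `N`. When `ν` is a character this set
is already a subgroup (`mem_charKer_iff` is the abelian case). -/
def charKer (ν : N → ℂ) : Subgroup N := Subgroup.closure {k | ν k = ν 1}

/-- The kernel of `ν` as a subgroup of `G_ν`. -/
def kerInStab (ν : N → ℂ) : Subgroup (stab N ν) :=
  ((charKer N ν).map N.subtype).subgroupOf (stab N ν)

instance kerInStab_normal (ν : N → ℂ) : (kerInStab N ν).Normal where
  conj_mem := by
    rintro ⟨x, hx⟩ hxk ⟨g, hg⟩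
    simp only [kerInStab, Subgroup.mem_subgroupOf, Subgroup.mem_map] at hxk ⊢
    obtain ⟨k, hk, hkx⟩ := hxk
    refine ⟨MulAut.conjNormal g k, ?_, by simp [← hkx]⟩
    have hle : charKer N ν ≤ (charKer N ν).comap (MulAut.conjNormal g : MulAut N).toMonoidHom := by
      refine (Subgroup.closure_le _).2 fun y hy => Subgroup.subset_closure ?_
      exact (hg y).trans hy
    exact hle hk

/-- For abelian `N` the kernel of an irreducible character `ν` is the set `{k | ν k = ν 1}`. -/
theorem mem_charKer_iff (hN : IsElementaryAbelian N) {ν : N → ℂ} (hν : ν ∈ Irr N) (k : N) :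
    k ∈ charKer N ν ↔ ν k = ν 1 := by
  refine ⟨fun hk => ?_, fun hk => Subgroup.subset_closure hk⟩
  obtain ⟨n, ρ, hρ, rfl⟩ := hν
  obtain ⟨p, hcomm, -⟩ := hN
  have : IsMulCommutative N := ⟨⟨fun a b => Subtype.ext (hcomm a a.2 b b.2)⟩⟩
  have h1 : Module.finrank ℂ (Fin n → ℂ) = 1 :=
    Representation.IsIrreducible.finrank_eq_one_of_isMulCommutative ρ
  obtain rfl : n = 1 := by simpa using h1
  have hid : ∀ y : N, ρ.character y = ρ.character 1 → ρ y = 1 := by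
    intro y hy
    have htr : LinearMap.trace ℂ (Fin 1 → ℂ) (ρ y) = 1 := by
      have h2 := Representation.char_one ρ
      rw [h1] at h2
      exact (hy.trans h2).trans (by simp)
    rw [LinearMap.trace_eq_matrix_trace ℂ (Pi.basisFun ℂ (Fin 1))] at htr
    apply (LinearMap.toMatrix (Pi.basisFun ℂ (Fin 1)) (Pi.basisFun ℂ (Fin 1))).injective
    ext i j
    obtain rfl : i = 0 := Subsingleton.elim _ _
    obtain rfl : j = 0 := Subsingleton.elim _ _
    simpa [Matrix.trace, Module.End.one_eq_id] using htr
  have hle : charKer N ρ.character ≤ MonoidHom.ker ρ :=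
    (Subgroup.closure_le _).2 fun y hy => hid y hy
  have hk1 : ρ k = 1 := hle hk
  simp only [Representation.character, hk1, map_one]

/-- `ν ∈ Irr(N)` extends to a character of its centraliser `G_ν`. -/
def ExtendsToStab (ν : N → ℂ) (hν : ν ∈ Irr N) : Prop :=
  ∃ χ ∈ Irr (stab N ν), ∀ k : N, χ (Subgroup.inclusion (le_stab N hν) k) = ν k

/-- `G` has balanced action on `Irr(N)`: `N` lies in a Hall `π`-subgroup `A` such that
`A_ν = A ∩ G_ν` is a Hall `π`-subgroup of `G_ν` for every `ν ∈ Irr(N)`, or the same holds with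
`π'` instead of `π`. -/
def HasBalancedAction (π : Set Nat.Primes) : Prop :=
  (∃ A : Subgroup G, IsHall π A ∧ N ≤ A ∧
    ∀ ν ∈ Irr N, IsHall π (A.subgroupOf (stab N ν))) ∨
  (∃ B : Subgroup G, IsHall πᶜ B ∧ N ≤ B ∧
    ∀ ν ∈ Irr N, IsHall πᶜ (B.subgroupOf (stab N ν)))

end

end HallConj

open HallConj

/-! The number of commuting pairs in a finite group `X` is |X| ccl(X). By orthogonality of the
linear characters ψ of the abelian group `N`, |N| |X| ccl(X) is the sum over ψ of `commSum X
(charExt N ψ)`. If `N ≤ X`, only pairs from X ∩ G_ψ contribute (`commSum_eq_commSum_inf`). So the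
class numbers of `G` and of the Hall subgroup `A` containing `N` can be compared one ψ at a time
inside T = G_ψ, where balance makes A ∩ T a Hall subgroup.

Let `C` be a Hall π'-subgroup of `T`. The local claim is that the sum over `T` is at most the sum
over A ∩ T times |C| ccl(C). If ψ is 1 on the commutators lying in `N`, as when it extends to `T`,
both sums count pairs that commute modulo `N`, and Con for T/N applies. Otherwise divide by ker ψ:
the image `M` of `N` becomes central of prime order, and the sum is proportional to ccl(X) -
ccl(X/M), which SCon controls. Finally `C` is conjugate into `B`, so |C| ccl(C) ≤ |B| ccl(B), and
summing over ψ gives Con.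

If equality holds, it holds for each ψ. The trivial ψ gives equality for G/N, so Con* makes G/N a
direct product and A and BN are normal in G. Each ψ is fixed by a conjugate of `B`, hence by `B`
itself because BN is normal and `N` fixes ψ. So `B` centralises `N`, which makes it normal, and G =
A × B. -/

namespace HallConj

open scoped commutatorElement

/-! ### Sums over commutators and class numbers -/

section CommutatorSums

variable {G Q : Type*} [Group G] [Group Q]

/-- The sum of the values of `φ` at all commutators of pairs of elements of `X`. -/
noncomputable def commSum (X : Subgroup G) (φ : G → ℂ) : ℂ :=
  ∑ᶠ p : X × X, φ ⁅(p.1 : G), (p.2 : G)⁆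

theorem commSum_eq (X : Subgroup G) [Fintype X] (φ : G → ℂ) :
    commSum X φ = ∑ x : X, ∑ y : X, φ ⁅(x : G), (y : G)⁆ := by
  rw [commSum, finsum_eq_sum_of_fintype, Fintype.sum_prod_type]

theorem sum_comp_of_surjective {H K : Type*} [Group H] [Group K] [Fintype H] [Fintype K]
    (f : H →* K) (hf : Function.Surjective f) (F : K → ℂ) :
    ∑ x, F (f x) = Nat.card f.ker * ∑ q, F q := by
  classical
  rw [← Finset.sum_fiberwise_of_maps_to (s := Finset.univ) (t := Finset.univ) (g := f)
    (fun _ _ => Finset.mem_univ _), Finset.mul_sum]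
  refine Finset.sum_congr rfl fun q _ => ?_
  rw [Finset.sum_congr rfl (g := fun _ => F q) (fun x hx => by rw [(Finset.mem_filter.1 hx).2]),
    Finset.sum_const, nsmul_eq_mul,
    MonoidHom.card_fiber_eq_of_mem_range f (x := q) (y := 1) (hf q) (hf 1)]
  congr 2
  rw [Nat.card_eq_fintype_card, Fintype.card_subtype]
  simp only [MonoidHom.mem_ker]

theorem card_ker_subgroupMap (f : G →* Q) (X : Subgroup G) (h : f.ker ≤ X) :
    Nat.card (f.subgroupMap X).ker = Nat.card f.ker := by
  refine Nat.card_congr ⟨fun x => ⟨x.1.1, ?_⟩, fun x => ⟨⟨x.1, h x.2⟩, ?_⟩, fun _ => rfl,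
    fun _ => rfl⟩
  · have := x.2
    rw [MonoidHom.mem_ker, Subtype.ext_iff] at this
    exact this
  · rw [MonoidHom.mem_ker, Subtype.ext_iff]
    exact MonoidHom.mem_ker.1 x.2

theorem card_map_mul_card_ker (f : G →* Q) (X : Subgroup G) (h : f.ker ≤ X) :
    Nat.card (X.map f) * Nat.card f.ker = Nat.card X := by
  rw [← card_ker_subgroupMap f X h, ← (f.subgroupMap X).ker.card_mul_index, mul_comm,
    Subgroup.index_ker, MonoidHom.range_eq_top.2 (f.subgroupMap_surjective X), Subgroup.card_top]

/-- Each pair in the image has |ker f|² preimages in `X × X`, because `X` contains the kernel. -/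
theorem commSum_comp [Finite G] (f : G →* Q) (X : Subgroup G) (h : f.ker ≤ X) (φ : Q → ℂ) :
    commSum X (fun g => φ (f g)) = (Nat.card f.ker : ℂ) ^ 2 * commSum (X.map f) φ := by
  have := Fintype.ofFinite X
  have : Finite (X.map f) := Finite.of_surjective _ (f.subgroupMap_surjective X)
  have := Fintype.ofFinite (X.map f)
  have hs := f.subgroupMap_surjective X
  have hk := card_ker_subgroupMap f X h
  rw [commSum_eq, commSum_eq]
  have h1 : ∀ x : X, ∑ y : X, φ (f ⁅(x : G), (y : G)⁆) =
      Nat.card f.ker * ∑ q : X.map f, φ ⁅(f.subgroupMap X x : Q), (q : Q)⁆ := by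
    intro x
    rw [← hk, ← sum_comp_of_surjective _ hs (fun q => φ ⁅(f.subgroupMap X x : Q), (q : Q)⁆)]
    simp [map_commutatorElement]
  rw [Finset.sum_congr rfl fun x _ => h1 x, ← Finset.mul_sum,
    sum_comp_of_surjective _ hs (fun p : X.map f => ∑ q : X.map f, φ ⁅(p : Q), (q : Q)⁆), hk]
  ring

theorem commSum_subgroupOf [Finite G] (X H : Subgroup G) (φ : G → ℂ) :
    commSum (X.subgroupOf H) (fun g => φ g) = commSum (X ⊓ H) φ := by
  have h1 := commSum_comp H.subtype (X.subgroupOf H) (by simp) φ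
  rw [Subgroup.subgroupOf_map_subtype] at h1
  simpa using h1

theorem commSum_indicator_one [Finite G] (X : Subgroup G) :
    commSum X (({1} : Set G).indicator 1) = Nat.card X * ccl X := by
  classical
  have := Fintype.ofFinite X
  have h := card_comm_eq_card_conjClasses_mul_card X
  rw [commSum, finsum_eq_sum_of_fintype, ccl, mul_comm, ← Nat.cast_mul, ← h,
    Nat.card_eq_fintype_card, Fintype.card_subtype, Finset.card_filter, Nat.cast_sum]
  refine Finset.sum_congr rfl fun p _ => ?_
  have : ⁅(p.1 : G), (p.2 : G)⁆ = 1 ↔ Commute p.1 p.2 := by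
    rw [commutatorElement_eq_one_iff_commute, Commute, SemiconjBy, Commute, SemiconjBy,
      Subtype.ext_iff]
    rfl
  by_cases hp : Commute p.1 p.2 <;> simp [Set.indicator, this, hp]

theorem commSum_indicator [Finite G] (N : Subgroup G) [N.Normal] (X : Subgroup G) (h : N ≤ X) :
    commSum X ((N : Set G).indicator 1) =
      Nat.card N * Nat.card X * ccl (X.map (QuotientGroup.mk' N)) := by
  have hk : (QuotientGroup.mk' N).ker ≤ X := by simpa using h
  have h1 := commSum_comp (QuotientGroup.mk' N) X hk (({1} : Set (G ⧸ N)).indicator 1)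
  have h2 : (fun g => ({1} : Set (G ⧸ N)).indicator (1 : G ⧸ N → ℂ) (QuotientGroup.mk' N g)) =
      (N : Set G).indicator 1 := by
    ext g
    by_cases hg : g ∈ N <;> simp [Set.indicator, hg]
  rw [h2, commSum_indicator_one] at h1
  rw [h1, ← card_map_mul_card_ker _ X hk, QuotientGroup.ker_mk']
  push_cast
  ring

theorem ccl_congr {H K : Type*} [Group H] [Group K] (e : H ≃* K) : ccl H = ccl K := by
  refine Nat.card_congr ⟨ConjClasses.map e.toMonoidHom, ConjClasses.map e.symm.toMonoidHom, ?_, ?_⟩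
  · intro x
    obtain ⟨a, rfl⟩ := ConjClasses.mk_surjective x
    change ConjClasses.mk _ = ConjClasses.mk _
    simp
  · intro x
    obtain ⟨a, rfl⟩ := ConjClasses.mk_surjective x
    change ConjClasses.mk _ = ConjClasses.mk _
    simp

theorem ccl_top : ccl (⊤ : Subgroup G) = ccl G := ccl_congr Subgroup.topEquiv

theorem ccl_pos (H : Type*) [Group H] [Finite H] : 0 < ccl H :=
  have : Nonempty (ConjClasses H) := ⟨1⟩
  Nat.card_pos

theorem ccl_quotient_subgroupOf (N : Subgroup G) [N.Normal] (X : Subgroup G) :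
    ccl (X ⧸ N.subgroupOf X) = ccl (X.map (QuotientGroup.mk' N)) := by
  have h : N.subgroupOf X = ((QuotientGroup.mk' N).subgroupMap X).ker := by
    ext x
    rw [MonoidHom.mem_ker, Subtype.ext_iff]
    simp [Subgroup.mem_subgroupOf]
  exact ccl_congr ((QuotientGroup.quotientMulEquivOfEq h).trans
    (QuotientGroup.quotientKerEquivOfSurjective _ (MonoidHom.subgroupMap_surjective _ X)))

/-- Restriction to a subgroup does not increase the number of commuting pairs. -/
theorem card_mul_ccl_le [Finite G] {H K : Subgroup G} (h : H ≤ K) :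
    Nat.card H * ccl H ≤ Nat.card K * ccl K := by
  have h1 := card_comm_eq_card_conjClasses_mul_card H
  have h2 := card_comm_eq_card_conjClasses_mul_card K
  rw [ccl, mul_comm, ← h1, ccl, mul_comm, ← h2]
  refine Nat.card_le_card_of_injective (fun p => ⟨(Subgroup.inclusion h p.1.1,
    Subgroup.inclusion h p.1.2), p.2.map (Subgroup.inclusion h)⟩) ?_
  rintro ⟨⟨a, b⟩, _⟩ ⟨⟨c, d⟩, _⟩ e
  simpa only [Subtype.mk.injEq, Prod.mk.injEq, (Subgroup.inclusion_injective _).eq_iff] using e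

/-- For g in `K` outside `H`, the commuting pair (g, 1) is new. This strictness drives the equality
case. -/
theorem card_mul_ccl_lt [Finite G] {H K : Subgroup G} (h : H < K) :
    Nat.card H * ccl H < Nat.card K * ccl K := by
  obtain ⟨hle, g, hg, hgH⟩ := SetLike.lt_iff_le_and_exists.1 h
  have h1 := card_comm_eq_card_conjClasses_mul_card H
  have h2 := card_comm_eq_card_conjClasses_mul_card K
  rw [ccl, mul_comm, ← h1, ccl, mul_comm, ← h2]
  have := Fintype.ofFinite { p : H × H // Commute p.1 p.2 }
  have := Fintype.ofFinite { p : K × K // Commute p.1 p.2 }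
  rw [Nat.card_eq_fintype_card, Nat.card_eq_fintype_card]
  refine Fintype.card_lt_of_injective_of_notMem (fun p => ⟨(Subgroup.inclusion hle p.1.1,
    Subgroup.inclusion hle p.1.2), p.2.map (Subgroup.inclusion hle)⟩) ?_
    (b := ⟨(⟨g, hg⟩, 1), Commute.one_right _⟩) ?_
  · rintro ⟨⟨a, b⟩, _⟩ ⟨⟨c, d⟩, _⟩ e
    simpa only [Subtype.mk.injEq, Prod.mk.injEq, (Subgroup.inclusion_injective _).eq_iff] using e
  · rintro ⟨⟨⟨a, b⟩, _⟩, e⟩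
    simp only [Subtype.ext_iff, Prod.ext_iff] at e
    exact hgH (e.1 ▸ a.2)

/-- A nontrivial element of `N` and 1 lie in different classes that merge in the quotient. This
makes the `A`-side sum positive in the SCon case. -/
theorem ccl_map_lt [Finite G] (N : Subgroup G) [N.Normal] (hN : N ≠ ⊥) (X : Subgroup G)
    (h : N ≤ X) : ccl (X.map (QuotientGroup.mk' N)) < ccl X := by
  rw [← ccl_quotient_subgroupOf, ccl, ccl]
  have := Fintype.ofFinite (ConjClasses X)
  have := Fintype.ofFinite (ConjClasses (X ⧸ N.subgroupOf X))
  rw [Nat.card_eq_fintype_card, Nat.card_eq_fintype_card]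
  obtain ⟨n, hn1⟩ := Subgroup.ne_bot_iff_exists_ne_one.1 hN
  refine Fintype.card_lt_of_surjective_not_injective
    (ConjClasses.map (QuotientGroup.mk' (N.subgroupOf X)))
    (ConjClasses.map_surjective (QuotientGroup.mk'_surjective _)) fun hinj => ?_
  have : ConjClasses.mk (⟨n, h n.2⟩ : X) = ConjClasses.mk 1 := by
    apply hinj
    change ConjClasses.mk _ = ConjClasses.mk _
    rw [map_one]
    congr 1
    rw [QuotientGroup.mk'_apply, QuotientGroup.eq_one_iff]
    exact n.2
  rw [ConjClasses.mk_eq_mk_iff_isConj, isConj_one_left] at this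
  exact hn1 (Subtype.ext (congrArg (fun x : X => (x : G)) this))

end CommutatorSums

/-! ### Linear characters of a normal subgroup extended by zero -/

section LinearOn

variable {G : Type*} [Group G]

/-- `φ` is a linear character of the subgroup `N`, extended by zero to the whole group. -/
structure IsLinearOn (N : Subgroup G) (φ : G → ℂ) : Prop where
  map_one : φ 1 = 1
  map_mul : ∀ x ∈ N, ∀ y ∈ N, φ (x * y) = φ x * φ y
  eq_zero : ∀ x ∉ N, φ x = 0

namespace IsLinearOn

variable {N : Subgroup G} {φ : G → ℂ}

theorem mul_map_inv (hφ : IsLinearOn N φ) {n : G} (hn : n ∈ N) : φ n * φ n⁻¹ = 1 := by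
  rw [← hφ.map_mul n hn _ (N.inv_mem hn), mul_inv_cancel, hφ.map_one]

theorem map_mul_left (hφ : IsLinearOn N φ) {n : G} (hn : n ∈ N) (g : G) :
    φ (n * g) = φ n * φ g := by
  by_cases hg : g ∈ N
  · exact hφ.map_mul n hn g hg
  · rw [hφ.eq_zero g hg, hφ.eq_zero _ (fun h => hg ((N.mul_mem_cancel_left hn).1 h)), mul_zero]

theorem map_mul_right (hφ : IsLinearOn N φ) {n : G} (hn : n ∈ N) (g : G) :
    φ (g * n) = φ n * φ g := by
  by_cases hg : g ∈ N
  · rw [hφ.map_mul g hg n hn, mul_comm]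
  · rw [hφ.eq_zero g hg, hφ.eq_zero _ (fun h => hg ((N.mul_mem_cancel_right hn).1 h)), mul_zero]

theorem map_conj_of_mem (hφ : IsLinearOn N φ) {g n : G} (hg : g ∈ N) :
    φ (g * n * g⁻¹) = φ n := by
  rw [hφ.map_mul_right (N.inv_mem hg), hφ.map_mul_left hg, ← mul_assoc, mul_comm (φ g⁻¹),
    hφ.mul_map_inv hg, one_mul]

end IsLinearOn

theorem sum_eq_zero_of_mul_left {X : Subgroup G} [Fintype X] (F : G → ℂ) {n : G} (hn : n ∈ X)
    {c : ℂ} (hc : c ≠ 1) (h : ∀ y, F (n * y) = c * F y) : ∑ y : X, F y = 0 := by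
  have h1 : ∑ y : X, F y = c * ∑ y : X, F y := by
    rw [Finset.mul_sum, ← Equiv.sum_comp (Equiv.mulLeft (⟨n, hn⟩ : X)) (fun y : X => F y)]
    exact Finset.sum_congr rfl fun y _ => h y
  have h2 : (1 - c) * ∑ y : X, F y = 0 := by linear_combination h1
  exact (mul_eq_zero.1 h2).resolve_left (sub_ne_zero.2 hc.symm)

theorem sum_subgroup_of_le {X Y : Subgroup G} [Fintype X] [Fintype Y] (hYX : Y ≤ X) (F : G → ℂ)
    (h : ∀ x ∈ X, x ∉ Y → F x = 0) : ∑ x : X, F x = ∑ y : Y, F y := by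
  refine (Fintype.sum_of_injective (Subgroup.inclusion hYX) (Subgroup.inclusion_injective _)
    _ _ (fun x hx => h x x.2 fun hxY => hx ⟨⟨x, hxY⟩, rfl⟩) fun _ => rfl).symm

/-- Only pairs of elements which fix the linear character contribute to its commutator sum. -/
theorem commSum_eq_commSum_inf [Finite G] {N T : Subgroup G} [N.Normal] {φ : G → ℂ}
    (hφ : IsLinearOn N φ) (hT : ∀ g, g ∈ T ↔ ∀ n ∈ N, φ (g * n * g⁻¹) = φ n) {X : Subgroup G}
    (hX : N ≤ X) : commSum X φ = commSum (X ⊓ T) φ := by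
  have := Fintype.ofFinite X
  have := Fintype.ofFinite ↥(X ⊓ T)
  have hNT : N ≤ T := fun g hg => (hT g).2 fun n _ => hφ.map_conj_of_mem hg
  have hex : ∀ g ∉ T, ∃ n ∈ N, φ (g * n * g⁻¹) ≠ φ n := by
    intro g hg
    rw [hT] at hg
    push Not at hg
    exact hg
  have key : ∀ {n a : G}, n ∈ N → φ a ≠ φ n → φ a * φ n⁻¹ ≠ 1 := by
    intro n a hn ha h
    apply ha
    linear_combination φ n * h - φ a * hφ.mul_map_inv hn
  -- Replacing y by ny multiplies the term by φ(xnx⁻¹)φ(n⁻¹), which is not 1 for a suitable n in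
  -- `N`.
  have h1 : ∀ x ∈ X, x ∉ T → ∑ y : X, φ ⁅x, (y : G)⁆ = 0 := by
    intro x _ hxT
    obtain ⟨n, hn, hne⟩ := hex x hxT
    refine sum_eq_zero_of_mul_left (fun y => φ ⁅x, y⁆) (hX hn) (key hn hne) fun y => ?_
    have : ⁅x, n * y⁆ = x * n * x⁻¹ * (⁅x, y⁆ * n⁻¹) := by
      simp only [commutatorElement_def]; group
    rw [this, hφ.map_mul_left (Subgroup.Normal.conj_mem ‹_› n hn x),
      hφ.map_mul_right (N.inv_mem hn)]
    ring
  -- Here x is already confined to `X ⊓ T`; translation of x by n⁻¹ is still allowed because `N`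
  -- lies in `T`.
  have h2 : ∀ y ∈ X, y ∉ T → ∑ x : ↥(X ⊓ T), φ ⁅(x : G), y⁆ = 0 := by
    intro y _ hyT
    obtain ⟨n, hn, hne⟩ := hex y hyT
    have hn' := N.inv_mem hn
    refine sum_eq_zero_of_mul_left (fun x => φ ⁅x, y⁆) (n := n⁻¹) ⟨hX hn', hNT hn'⟩
      (key hn hne) fun x => ?_
    have : ⁅n⁻¹ * x, y⁆ = n⁻¹ * (⁅x, y⁆ * (y * n * y⁻¹)) := by
      simp only [commutatorElement_def]; group
    rw [this, hφ.map_mul_left hn', hφ.map_mul_right (Subgroup.Normal.conj_mem ‹_› n hn y)]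
    ring
  rw [commSum_eq, commSum_eq,
    sum_subgroup_of_le (Y := X ⊓ T) inf_le_left (fun x => ∑ y : X, φ ⁅x, (y : G)⁆)
      (fun x hx hx' => h1 x hx fun h => hx' ⟨hx, h⟩), Finset.sum_comm,
    sum_subgroup_of_le (Y := X ⊓ T) inf_le_left (fun y => ∑ x : ↥(X ⊓ T), φ ⁅(x : G), y⁆)
      (fun x hx hx' => h2 x hx fun h => hx' ⟨hx, h⟩), Finset.sum_comm]

open Classical in
/-- The extension by zero of a character of `N`. -/
noncomputable def charExt (N : Subgroup G) (ψ : AddChar (Additive N) ℂ) (g : G) : ℂ :=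
  if h : g ∈ N then ψ (Additive.ofMul ⟨g, h⟩) else 0

theorem charExt_coe {N : Subgroup G} (ψ : AddChar (Additive N) ℂ) (n : N) :
    charExt N ψ n = ψ (Additive.ofMul n) := by
  simp [charExt]

theorem isLinearOn_charExt {N : Subgroup G} (ψ : AddChar (Additive N) ℂ) :
    IsLinearOn N (charExt N ψ) where
  map_one := by
    have := charExt_coe ψ 1
    rwa [OneMemClass.coe_one, ofMul_one, AddChar.map_zero_eq_one] at this
  map_mul x hx y hy := by
    have := charExt_coe ψ (⟨x, hx⟩ * ⟨y, hy⟩)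
    rw [ofMul_mul, AddChar.map_add_eq_mul, ← charExt_coe, ← charExt_coe] at this
    exact this
  eq_zero x hx := by simp [charExt, hx]

open scoped IsMulCommutative in
theorem sum_charExt [Finite G] (N : Subgroup G) [IsMulCommutative N]
    [Fintype (AddChar (Additive N) ℂ)] (g : G) :
    ∑ ψ : AddChar (Additive N) ℂ, charExt N ψ g =
      Nat.card N * ({1} : Set G).indicator 1 g := by
  classical
  have := Fintype.ofFinite N
  by_cases hg : g ∈ N
  · have h := AddChar.sum_apply_eq_ite (Additive.ofMul (⟨g, hg⟩ : N))
    have h2 : ∑ ψ : AddChar (Additive N) ℂ, charExt N ψ g =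
        ∑ ψ : AddChar (Additive N) ℂ, ψ (Additive.ofMul (⟨g, hg⟩ : N)) :=
      Finset.sum_congr rfl fun ψ _ => charExt_coe ψ ⟨g, hg⟩
    have h3 : Additive.ofMul (⟨g, hg⟩ : N) = 0 ↔ g = 1 := by
      rw [ofMul_eq_zero, Subtype.ext_iff, OneMemClass.coe_one]
    rw [h2]
    refine Eq.trans ?_ (h.trans ?_)
    · refine Finset.sum_congr ?_ fun _ _ => rfl
      ext
      simp
    by_cases hg1 : g = 1
    · rw [if_pos (h3.2 hg1), hg1, Nat.card_eq_fintype_card]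
      simp
    · rw [if_neg fun h => hg1 (h3.1 h)]
      simp [hg1]
  · have : g ≠ 1 := fun h => hg (h ▸ N.one_mem)
    simp [charExt, hg, this]

theorem isLinearOn_charExt_restrict {N : Subgroup G} {ψ : AddChar (Additive N) ℂ} (T : Subgroup G) :
    IsLinearOn (N.subgroupOf T) (fun x : T => charExt N ψ x) where
  map_one := (isLinearOn_charExt ψ).map_one
  map_mul x hx y hy := (isLinearOn_charExt ψ).map_mul x hx y hy
  eq_zero x hx := (isLinearOn_charExt ψ).eq_zero x hx

open scoped IsMulCommutative in
-- Characters of `N` separate points: otherwise all of them take the value 1 at the nontrivial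
-- element xy⁻¹, and their sum there could not vanish.
theorem charExt_eq_of_forall [Finite G] {N : Subgroup G} [IsMulCommutative N] {x y : G} (hx : x ∈ N) (hy : y ∈ N)
    (h : ∀ ψ : AddChar (Additive N) ℂ, charExt N ψ x = charExt N ψ y) : x = y := by
  have := Fintype.ofFinite (AddChar (Additive N) ℂ)
  have h1 := sum_charExt N (x * y⁻¹)
  have h2 : ∀ ψ : AddChar (Additive N) ℂ, charExt N ψ (x * y⁻¹) = 1 := fun ψ => by
    rw [(isLinearOn_charExt ψ).map_mul_left hx, h, (isLinearOn_charExt ψ).mul_map_inv hy]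
  by_contra hne
  have h3 : x * y⁻¹ ≠ 1 := fun h => hne (mul_inv_eq_one.1 h)
  simp [h2, h3] at h1

theorem card_mul_ccl_eq_sum [Finite G] (N : Subgroup G) [IsMulCommutative N]
    [Fintype (AddChar (Additive N) ℂ)] (X : Subgroup G) :
    (Nat.card N * (Nat.card X * ccl X) : ℂ) =
      ∑ ψ : AddChar (Additive N) ℂ, commSum X (charExt N ψ) := by
  have := Fintype.ofFinite X
  rw [← commSum_indicator_one, commSum_eq]
  simp_rw [commSum_eq]
  rw [Finset.mul_sum]
  refine Eq.trans (Finset.sum_congr rfl fun x _ => ?_) Finset.sum_comm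
  rw [Finset.mul_sum]
  refine Eq.trans (Finset.sum_congr rfl fun y _ => ?_) Finset.sum_comm
  rw [sum_charExt]

theorem commSum_eq_sum [Finite G] (M : Subgroup G) [Fintype M] (X : Subgroup G) (F : G → ℂ)
    (hF : ∀ x ∉ M, F x = 0) :
    commSum X F = ∑ m : M, F m * Nat.card {p : X × X // ⁅(p.1 : G), (p.2 : G)⁆ = m} := by
  classical
  have := Fintype.ofFinite X
  simp_rw [Nat.card_eq_fintype_card, Fintype.card_subtype, Finset.card_filter, Nat.cast_sum,
    Finset.mul_sum]
  rw [commSum, finsum_eq_sum_of_fintype, Finset.sum_comm]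
  refine Finset.sum_congr rfl fun p _ => ?_
  by_cases h : ⁅(p.1 : G), (p.2 : G)⁆ ∈ M
  · rw [Finset.sum_eq_single ⟨_, h⟩]
    · simp
    · rintro m - hm
      rw [if_neg fun h' => hm (Subtype.ext h'.symm)]
      simp
    · simp
  · rw [hF _ h, Finset.sum_eq_zero]
    rintro m -
    rw [if_neg (fun h' => h (by rw [h']; exact m.2))]
    simp

theorem commutatorElement_pow_right_of_mem_center {x y : G} (h : ⁅x, y⁆ ∈ Subgroup.center G)
    (k : ℕ) : ⁅x, y ^ k⁆ = ⁅x, y⁆ ^ k := by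
  have h1 : x * y * x⁻¹ = ⁅x, y⁆ * y := by simp [commutatorElement_def]
  have h2 : Commute ⁅x, y⁆ y := (Subgroup.mem_center_iff.1 h y).symm
  rw [commutatorElement_def x (y ^ k), ← conj_pow, h1, h2.mul_pow, mul_inv_cancel_right]

/-- Units modulo `p` lift to units modulo `n`. -/
theorem exists_coprime_modEq {p n j : ℕ} [NeZero n] (hp : p ∣ n) (hj : j.Coprime p) :
    ∃ k : ℕ, k.Coprime n ∧ k ≡ j [MOD p] := by
  obtain ⟨u, hu⟩ := ZMod.unitsMap_surjective hp (ZMod.unitOfCoprime j hj)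
  refine ⟨(u : ZMod n).val, ZMod.val_coe_unit_coprime u, ?_⟩
  have := congrArg Units.val hu
  rw [ZMod.unitsMap_val, ZMod.coe_unitOfCoprime] at this
  rw [← ZMod.natCast_eq_natCast_iff, ← this, ZMod.cast_eq_val]

/-- Write m' = m^j and choose k ≡ j mod `p` coprime to |X|. Then (x, y) ↦ (x, y^k) is injective, and
it raises a central commutator to its k-th power. -/
theorem card_commutator_eq_le [Finite G] {p : ℕ} [Fact p.Prime] (M : Subgroup G)
    (hM : M ≤ Subgroup.center G) (hp : Nat.card M = p) {X : Subgroup G} (hX : M ≤ X) {m m' : M}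
    (hm : m ≠ 1) (hm' : m' ≠ 1) :
    Nat.card {q : X × X // ⁅(q.1 : G), (q.2 : G)⁆ = m} ≤
      Nat.card {q : X × X // ⁅(q.1 : G), (q.2 : G)⁆ = m'} := by
  obtain ⟨j, rfl⟩ := mem_powers_of_prime_card (g := m) (g' := m') hp hm
  have ho : orderOf m = p := orderOf_eq_prime (hp ▸ pow_card_eq_one') hm
  have hj : j.Coprime p := by
    rw [Nat.coprime_comm, Nat.Prime.coprime_iff_not_dvd Fact.out]
    rintro ⟨t, rfl⟩
    apply hm'
    simp only [pow_mul]
    rw [← ho, pow_orderOf_eq_one, one_pow]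
  have : NeZero (Nat.card X) := ⟨Nat.card_pos.ne'⟩
  obtain ⟨k, hk, hkj⟩ := exists_coprime_modEq (hp ▸ Subgroup.card_dvd_of_le hX) hj
  have hmk : m ^ k = m ^ j := by rwa [pow_eq_pow_iff_modEq, ho]
  refine Nat.card_le_card_of_injective
    (fun q => ⟨(q.1.1, powCoprime hk.symm q.1.2), ?_⟩) ?_
  · have hc : ⁅(q.1.1 : G), (q.1.2 : G)⁆ ∈ Subgroup.center G := by
      rw [q.2]; exact hM m.2
    simp only [powCoprime_apply, Subgroup.coe_pow]
    rw [commutatorElement_pow_right_of_mem_center hc, q.2, ← Subgroup.coe_pow, hmk]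
    rfl
  · rintro ⟨⟨a, b⟩, _⟩ ⟨⟨c, d⟩, _⟩ e
    simpa only [Subtype.mk.injEq, Prod.mk.injEq, EmbeddingLike.apply_eq_iff_eq] using e

/-- All nontrivial characters of a central subgroup of prime order have the same commutator
sum. -/
theorem commSum_of_card_prime [Finite G] {p : ℕ} (hp : p.Prime) (M : Subgroup G) [M.Normal]
    (hM : M ≤ Subgroup.center G) (hMp : Nat.card M = p) {φ : G → ℂ} (hφ : IsLinearOn M φ)
    (hne : ∃ m ∈ M, φ m ≠ 1) {X : Subgroup G} (hX : M ≤ X) :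
    (p - 1 : ℂ) * commSum X φ =
      p * Nat.card X * (ccl X - ccl (X.map (QuotientGroup.mk' M))) := by
  classical
  have := Fact.mk hp
  have := Fintype.ofFinite M
  obtain ⟨m₀, hm₀, hm₀1⟩ := hne
  have hm₀' : (⟨m₀, hm₀⟩ : M) ≠ 1 := fun h => hm₀1 (by
    rw [show m₀ = 1 from congrArg Subtype.val h, hφ.map_one])
  set c : M → ℂ := fun m => Nat.card {q : X × X // ⁅(q.1 : G), (q.2 : G)⁆ = m} with hc
  have hconst : ∀ m : M, m ≠ 1 → c m = c ⟨m₀, hm₀⟩ := fun m hm => by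
    simp only [hc]
    exact_mod_cast le_antisymm (card_commutator_eq_le M hM hMp hX hm hm₀')
      (card_commutator_eq_le M hM hMp hX hm₀' hm)
  -- All nontrivial elements of `M` are commutators of equally many pairs, so the sum depends only
  -- on F(1), ΣF and two counts. Applying this to φ and to the indicators of {1} and `M` eliminates
  -- the counts.
  have hsum : ∀ F : G → ℂ, (∀ x ∉ M, F x = 0) →
      commSum X F = F 1 * (c 1 - c ⟨m₀, hm₀⟩) + (∑ m : M, F m) * c ⟨m₀, hm₀⟩ := by
    intro F hF
    rw [commSum_eq_sum M X F hF, ← Finset.add_sum_erase _ _ (Finset.mem_univ (1 : M)),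
      ← Finset.add_sum_erase _ (fun m : M => F m) (Finset.mem_univ (1 : M)), add_mul,
      Finset.sum_mul, Finset.sum_congr rfl fun m hm => congrArg (F (m : M) * ·)
        (hconst m (Finset.ne_of_mem_erase hm))]
    simp only [hc, OneMemClass.coe_one]
    ring
  have hφ0 : ∑ m : M, φ m = 0 := sum_eq_zero_of_mul_left φ hm₀ hm₀1 (hφ.map_mul_left hm₀)
  have h1 := hsum φ hφ.eq_zero
  have h2 := hsum (({1} : Set G).indicator 1) (fun x hx => by
    have : x ≠ 1 := fun h => hx (h ▸ M.one_mem)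
    simp [this])
  have h3 := hsum ((M : Set G).indicator 1) (fun x hx => by simp [hx])
  have e2 : ∑ m : M, ({1} : Set G).indicator (1 : G → ℂ) m = 1 := by
    rw [Finset.sum_eq_single 1] <;> simp +contextual [Set.indicator]
  have e3 : ∑ m : M, (M : Set G).indicator (1 : G → ℂ) m = p := by
    simp [← hMp]
  rw [hφ.map_one, hφ0] at h1
  rw [commSum_indicator_one, e2] at h2
  rw [commSum_indicator M X hX, e3, hMp] at h3
  simp at h2 h3
  rw [h1]
  linear_combination (-p : ℂ) * h2 + h3

end LinearOn

/-! ### Hall subgroups of finite soluble groups -/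

section Hall

/-- Every prime divisor of `n` lies in `π`. -/
def IsPiNumber (π : Set Nat.Primes) (n : ℕ) : Prop := ∀ p : Nat.Primes, (p : ℕ) ∣ n → p ∈ π

namespace IsPiNumber

variable {π : Set Nat.Primes} {m n : ℕ}

theorem of_dvd (hn : IsPiNumber π n) (h : m ∣ n) : IsPiNumber π m := fun p hp => hn p (hp.trans h)

theorem mul (hm : IsPiNumber π m) (hn : IsPiNumber π n) : IsPiNumber π (m * n) := fun p hp =>
  (p.2.dvd_mul.1 hp).elim (hm p) (hn p)

theorem coprime (hm : IsPiNumber π m) (hn : IsPiNumber πᶜ n) : m.Coprime n := by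
  rw [Nat.coprime_iff_gcd_eq_one]
  by_contra h
  obtain ⟨p, hp, hd⟩ := Nat.exists_prime_and_dvd h
  exact hn ⟨p, hp⟩ (hd.trans (Nat.gcd_dvd_right _ _)) (hm ⟨p, hp⟩ (hd.trans (Nat.gcd_dvd_left _ _)))

theorem of_pow {q : Nat.Primes} (hq : q ∈ π) (k : ℕ) : IsPiNumber π ((q : ℕ) ^ k) := by
  intro p hp
  have : p = q := Subtype.ext ((Nat.prime_dvd_prime_iff_eq p.2 q.2).1 (p.2.dvd_of_dvd_pow hp))
  exact this ▸ hq

end IsPiNumber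

variable {G : Type*} [Group G] {π : Set Nat.Primes}

theorem isHall_iff {A : Subgroup G} :
    IsHall π A ↔ IsPiNumber π (Nat.card A) ∧ IsPiNumber πᶜ A.index := Iff.rfl

namespace IsHall

variable {A B : Subgroup G}

theorem compl_compl (h : IsHall π A) : IsHall πᶜᶜ A := by rwa [_root_.compl_compl]

theorem map_of_surjective {Q : Type*} [Group Q] (h : IsHall π A) (f : G →* Q)
    (hf : Function.Surjective f) : IsHall π (A.map f) :=
  ⟨IsPiNumber.of_dvd (isHall_iff.1 h).1 (Subgroup.card_map_dvd A f),
    IsPiNumber.of_dvd (isHall_iff.1 h).2 (A.index_map_dvd hf)⟩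

theorem card_mul_card (hA : IsHall π A) (hB : IsHall πᶜ B) :
    Nat.card A * Nat.card B = Nat.card G := by
  rw [isHall_iff] at hA hB
  rw [_root_.compl_compl] at hB
  have h1 : (Nat.card B).Coprime B.index := (hB.2.coprime hB.1).symm
  have h3 : (Nat.card A).Coprime (Nat.card B) := hA.1.coprime hB.1
  have h4 : B.index.Coprime A.index := hB.2.coprime hA.2
  have e : Nat.card A * A.index = Nat.card B * B.index := by
    rw [A.card_mul_index, B.card_mul_index]
  have d1 : Nat.card B ∣ A.index := (h3.symm).dvd_of_dvd_mul_left (e ▸ dvd_mul_right _ _)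
  have d2 : A.index ∣ Nat.card B := h4.symm.dvd_of_dvd_mul_right (e ▸ dvd_mul_left _ _)
  rw [Nat.dvd_antisymm d1 d2, A.card_mul_index]

theorem card_eq [Finite G] (hA : IsHall π A) (hB : IsHall π B) : Nat.card A = Nat.card B := by
  have d : ∀ {A B : Subgroup G}, IsHall π A → IsHall π B → Nat.card A ∣ Nat.card B := by
    intro A B hA hB
    refine (IsPiNumber.coprime hA.1 hB.2).dvd_of_dvd_mul_right ?_
    rw [B.card_mul_index]
    exact A.card_subgroup_dvd_card
  exact Nat.dvd_antisymm (d hA hB) (d hB hA)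

/-- A Hall `π`-subgroup contains every normal `π`-subgroup. -/
theorem le_of_normal [Finite G] (hA : IsHall π A) {M : Subgroup G} [M.Normal]
    (hM : IsPiNumber π (Nat.card M)) : M ≤ A := by
  have h1 : A.relIndex (A ⊔ M) ∣ A.index := Subgroup.relIndex_dvd_index_of_le le_sup_left
  have h2 : A.relIndex (A ⊔ M) ∣ Nat.card M := by
    have e1 := Subgroup.relIndex_mul_relIndex ⊥ A (A ⊔ M) bot_le le_sup_left
    have e2 := Subgroup.relIndex_mul_relIndex ⊥ M (A ⊔ M) bot_le le_sup_right
    rw [Subgroup.relIndex_sup_right, ← e1, Subgroup.relIndex_bot_left,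
      Subgroup.relIndex_bot_left] at e2
    obtain ⟨u, hu⟩ := Subgroup.relIndex_dvd_card M A
    have hpos : 0 < M.relIndex A := Nat.pos_of_dvd_of_pos (Subgroup.relIndex_dvd_card M A)
      Nat.card_pos
    refine ⟨u, Nat.eq_of_mul_eq_mul_right hpos ?_⟩
    rw [e2]
    nth_rw 1 [hu]
    ring
  have h3 : A.relIndex (A ⊔ M) = 1 :=
    Nat.eq_one_of_dvd_coprimes (IsPiNumber.coprime hM hA.2) h2 h1
  exact le_sup_right.trans (Subgroup.relIndex_eq_one.1 h3)

/-- A normal Hall `π`-subgroup contains every `π`-subgroup. -/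
theorem le_of_normal' [Finite G] [A.Normal] (hA : IsHall π A) {P : Subgroup G}
    (hP : IsPiNumber π (Nat.card P)) : P ≤ A := by
  refine Subgroup.relIndex_eq_one.1 ?_
  exact Nat.eq_one_of_dvd_coprimes (IsPiNumber.coprime hP hA.2) (Subgroup.relIndex_dvd_card _ _)
    (Subgroup.relIndex_dvd_index_of_normal _ _)

theorem eq_of_normal [Finite G] [A.Normal] (hA : IsHall π A) (hB : IsHall π B) : B = A :=
  Subgroup.eq_of_le_of_card_ge (hA.le_of_normal' hB.1) (hA.card_eq hB).le

end IsHall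

open scoped Pointwise in
open MulAction MulOpposite in
/-- Complements of an abelian normal subgroup of coprime index are conjugate. -/
theorem exists_conj_of_isComplement' [Finite G] {M : Subgroup G} [IsMulCommutative M] [M.Normal]
    (hM : (Nat.card M).Coprime M.index) {K L : Subgroup G} (hK : M.IsComplement' K)
    (hL : M.IsComplement' L) : ∃ g : G, ∀ x ∈ K, g * x * g⁻¹ ∈ L := by
  -- As in the Schur–Zassenhaus theorem, `G` acts on classes of transversals of `M`, and `M` is
  -- transitive. Each complement is the full stabiliser of its own class, so an element moving one
  -- class to another conjugates the complements.
  let α : (K : Subgroup G) → M.IsComplement' K → M.QuotientDiff := fun K hK =>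
    Quotient.mk'' ⟨(K : Set G), hK.symm⟩
  have hle : ∀ (K : Subgroup G) (hK : M.IsComplement' K), K ≤ stabilizer G (α K hK) := by
    intro K hK k hk
    rw [mem_stabilizer_iff]
    change Quotient.mk'' (op k⁻¹ • (⟨(K : Set G), hK.symm⟩ : M.LeftTransversal)) = _
    congr 1
    apply Subtype.ext
    change op k⁻¹ • (K : Set G) = K
    exact op_smul_coe_set (K.inv_mem hk)
  have heq : ∀ (K : Subgroup G) (hK : M.IsComplement' K), K = stabilizer G (α K hK) := by
    intro K hK
    refine Subgroup.eq_of_le_of_card_ge (hle K hK) (le_of_eq ?_)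
    rw [← hK.symm.index_eq_card, ← (Subgroup.isComplement'_stabilizer_of_coprime hM).symm.index_eq_card]
  obtain ⟨h, hh⟩ := Subgroup.exists_smul_eq hM (α K hK) (α L hL)
  refine ⟨h, fun x hx => ?_⟩
  have hx' := hle K hK hx
  rw [mem_stabilizer_iff] at hx'
  rw [heq L hL, mem_stabilizer_iff, ← hh, Subgroup.smul_def, ← mul_smul, inv_mul_cancel_right,
    mul_smul, hx']

/-- The last nontrivial term of the derived series is abelian; its elements of order dividing a
prime `q` form the required subgroup. -/
theorem exists_normal_abelian_pGroup [Finite G] [Group.IsSolvable G] [Nontrivial G] :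
    ∃ (M : Subgroup G) (q : Nat.Primes), M.Normal ∧ IsMulCommutative M ∧ M ≠ ⊥ ∧
      IsPGroup q M := by
  classical
  have hex : ∃ n, derivedSeries G n = ⊥ := Group.IsSolvable.solvable
  obtain ⟨n, hn⟩ : ∃ n, Nat.find hex = n + 1 := by
    refine Nat.exists_eq_succ_of_ne_zero fun h => ?_
    have := Nat.find_spec hex
    rw [h, derivedSeries_zero] at this
    exact top_ne_bot this
  have h1 : ⁅derivedSeries G n, derivedSeries G n⁆ = ⊥ := by
    rw [← derivedSeries_succ, ← hn]
    exact Nat.find_spec hex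
  have h2 : derivedSeries G n ≠ ⊥ := Nat.find_min hex (by omega)
  set D := derivedSeries G n
  have hcomm : ∀ x ∈ D, ∀ y ∈ D, Commute x y := fun x hx y hy =>
    commutatorElement_eq_one_iff_commute.1
      (by simpa [h1] using Subgroup.commutator_mem_commutator hx hy)
  have hD : Nat.card D ≠ 1 := fun h => h2 (Subgroup.card_eq_one.1 h)
  obtain ⟨q, hq, hqd⟩ := Nat.exists_prime_and_dvd hD
  have := Fact.mk hq
  obtain ⟨x, hx⟩ := exists_prime_orderOf_dvd_card' q hqd
  let M : Subgroup G :=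
    { carrier := {x | x ∈ D ∧ x ^ q = 1}
      one_mem' := ⟨D.one_mem, one_pow q⟩
      mul_mem' := fun {a b} ha hb => ⟨D.mul_mem ha.1 hb.1, by
        rw [(hcomm a ha.1 b hb.1).mul_pow, ha.2, hb.2, one_mul]⟩
      inv_mem' := fun {a} ha => ⟨D.inv_mem ha.1, by rw [inv_pow, ha.2, inv_one]⟩ }
  refine ⟨M, ⟨q, hq⟩, ⟨fun a ha g => ⟨?_, ?_⟩⟩, ⟨⟨fun a b => ?_⟩⟩, fun h => ?_, fun a => ⟨1, ?_⟩⟩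
  · exact (inferInstance : D.Normal).conj_mem a ha.1 g
  · rw [conj_pow, ha.2, mul_one, mul_inv_cancel]
  · exact Subtype.ext (hcomm a a.2.1 b b.2.1)
  · have hxM : (x : G) ∈ M := ⟨x.2, by
      rw [← Subgroup.coe_pow, ← hx, pow_orderOf_eq_one, Subgroup.coe_one]⟩
    rw [h, Subgroup.mem_bot, OneMemClass.coe_eq_one] at hxM
    rw [hxM, orderOf_one] at hx
    exact hq.one_lt.ne hx
  · rw [pow_one]
    exact Subtype.ext a.2.2

/-- Hall's theorem: existence. -/
theorem exists_isHall (π : Set Nat.Primes) (G : Type*) [Group G] [Finite G]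
    [Group.IsSolvable G] : ∃ A : Subgroup G, IsHall π A := by
  induction hn : Nat.card G using Nat.strong_induction_on generalizing G with | _ n ih =>
  rcases subsingleton_or_nontrivial G with hG | hG
  · refine ⟨⊤, fun p hp => ?_, fun p hp => ?_⟩ 
    · rw [Nat.card_unique] at hp
      exact absurd (Nat.dvd_one.1 hp) p.2.ne_one
    · rw [Subgroup.index_top] at hp
      exact absurd (Nat.dvd_one.1 hp) p.2.ne_one
  obtain ⟨M, q, hMn, hMc, hM, hMq⟩ := exists_normal_abelian_pGroup (G := G)
  have := Fact.mk q.2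
  obtain ⟨k, hk⟩ := IsPGroup.iff_card.1 hMq
  have hlt : Nat.card (G ⧸ M) < n := by
    rw [← hn, Subgroup.card_eq_card_quotient_mul_card_subgroup M]
    exact lt_mul_right Nat.card_pos ((Subgroup.one_lt_card_iff_ne_bot M).2 hM)
  obtain ⟨A, hA⟩ := ih _ hlt (G ⧸ M) rfl
  set H := A.comap (QuotientGroup.mk' M) with hH
  have hMH : M ≤ H := by
    have := Subgroup.comap_mono (f := QuotientGroup.mk' M) (bot_le (a := A))
    rwa [MonoidHom.comap_bot, QuotientGroup.ker_mk'] at this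
  have hmap : H.map (QuotientGroup.mk' M) = A :=
    Subgroup.map_comap_eq_self_of_surjective (QuotientGroup.mk'_surjective M) A
  have hcard : Nat.card A * Nat.card M = Nat.card H := by
    have := card_map_mul_card_ker (QuotientGroup.mk' M) H (by simpa using hMH)
    rwa [hmap, QuotientGroup.ker_mk'] at this
  have hind : H.index = A.index :=
    A.index_comap_of_surjective (QuotientGroup.mk'_surjective M)
  by_cases hq : q ∈ π
  · refine ⟨H, ?_⟩
    rw [isHall_iff, hind, ← hcard, hk]
    exact ⟨IsPiNumber.mul hA.1 (.of_pow hq k), hA.2⟩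
  -- The preimage of `A` is too large by the factor |M|; a Schur–Zassenhaus complement of `M` in it
  -- has the order of `A`.
  · have hMπ : IsPiNumber πᶜ (Nat.card M) := hk ▸ IsPiNumber.of_pow hq k
    have hMc : Nat.card (M.subgroupOf H) = Nat.card M :=
      Nat.card_congr (Subgroup.subgroupOfEquivOfLe hMH).toEquiv
    have hMi : (M.subgroupOf H).index = Nat.card A := by
      have := (M.subgroupOf H).card_mul_index
      rw [hMc, ← hcard, mul_comm] at this
      exact Nat.eq_of_mul_eq_mul_right Nat.card_pos this
    obtain ⟨K, hK⟩ := Subgroup.exists_right_complement'_of_coprime (N := M.subgroupOf H)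
      (by rw [hMc, hMi]; exact (IsPiNumber.coprime hA.1 hMπ).symm)
    have hKc : Nat.card (K.map H.subtype) = Nat.card A := by
      rw [Subgroup.card_map_of_injective H.subtype_injective, ← hK.symm.index_eq_card, hMi]
    have hKi : (K.map H.subtype).index = Nat.card M * A.index := by
      have h1 := (K.map H.subtype).card_mul_index
      rw [← H.card_mul_index, hKc, hind, ← hcard, mul_assoc] at h1
      exact Nat.eq_of_mul_eq_mul_left Nat.card_pos h1
    refine ⟨K.map H.subtype, ?_⟩
    rw [isHall_iff, hKc, hKi]
    exact ⟨hA.1, hMπ.mul hA.2⟩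

theorem isComplement'_subgroupOf {M K R : Subgroup G} [M.Normal]
    (h : (Nat.card M).Coprime (Nat.card K)) (hR : R ≤ K ⊔ M) (hM : M ≤ R) (hK : K ≤ R) :
    (M.subgroupOf R).IsComplement' (K.subgroupOf R) := by
  apply Subgroup.IsComplement'.symm
  refine Subgroup.isComplement'_of_disjoint_and_mul_eq_univ ?_ ?_
  · rw [Subgroup.disjoint_def]
    intro x hx hx'
    exact Subtype.ext (Subgroup.disjoint_def.1 (Subgroup.disjoint_of_coprime_natCard h) hx' hx)
  · refine Set.eq_univ_of_forall fun x => ?_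
    obtain ⟨a, ha, b, hb, hab⟩ := Subgroup.mem_sup_of_normal_right.1 (hR x.2)
    exact ⟨⟨a, hK ha⟩, ha, ⟨b, hM hb⟩, hb, Subtype.ext hab⟩

/-- Hall's theorem: every `π`-subgroup is conjugate to a subgroup of any Hall `π`-subgroup. -/
theorem IsHall.exists_conj_mem {G : Type*} [Group G] [Finite G] [Group.IsSolvable G]
    {H P : Subgroup G} (hH : IsHall π H) (hP : IsPiNumber π (Nat.card P)) :
    ∃ g : G, ∀ x ∈ P, g * x * g⁻¹ ∈ H := by
  induction hn : Nat.card G using Nat.strong_induction_on generalizing G with | _ n ih =>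
  rcases subsingleton_or_nontrivial G with hG | hG
  · exact ⟨1, fun x _ => Subsingleton.elim 1 (1 * x * 1⁻¹) ▸ H.one_mem⟩
  obtain ⟨M, q, hMn, hMc, hM, hMq⟩ := exists_normal_abelian_pGroup (G := G)
  have := Fact.mk q.2
  obtain ⟨k, hk⟩ := IsPGroup.iff_card.1 hMq
  have hlt : Nat.card (G ⧸ M) < n := by
    rw [← hn, Subgroup.card_eq_card_quotient_mul_card_subgroup M]
    exact lt_mul_right Nat.card_pos ((Subgroup.one_lt_card_iff_ne_bot M).2 hM)
  obtain ⟨g', hg'⟩ := ih _ hlt (hH.map_of_surjective _ (QuotientGroup.mk'_surjective M))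
    (hP.of_dvd (Subgroup.card_map_dvd P (QuotientGroup.mk' M))) rfl
  obtain ⟨g, rfl⟩ := QuotientGroup.mk'_surjective M g'
  have hg : ∀ x ∈ P, g * x * g⁻¹ ∈ H ⊔ M := by
    intro x hx
    obtain ⟨h, hh, he⟩ := hg' _ (Subgroup.mem_map_of_mem _ hx)
    rw [← map_inv, ← map_mul, ← map_mul, QuotientGroup.mk'_eq_mk'] at he
    obtain ⟨z, hz, he⟩ := he
    rw [← he]
    exact Subgroup.mul_mem_sup hh hz
  by_cases hq : q ∈ π
  · have hMH : M ≤ H := hH.le_of_normal (hk ▸ IsPiNumber.of_pow hq k)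
    rw [sup_eq_left.2 hMH] at hg
    exact ⟨g, hg⟩
  · have hMπ : IsPiNumber πᶜ (Nat.card M) := hk ▸ IsPiNumber.of_pow hq k
    set P' := P.map (MulAut.conj g).toMonoidHom with hP'
    have hP'π : IsPiNumber π (Nat.card P') := hP.of_dvd (Subgroup.card_map_dvd _ _)
    have hP'le : P' ≤ H ⊔ M := by
      rintro _ ⟨x, hx, rfl⟩
      exact hg x hx
    -- Both `P'` and `H ⊓ R` are complements of `M` in `R`, so they are conjugate there.
    set R := P' ⊔ M with hR
    have hRle : R ≤ (H ⊓ R) ⊔ M := by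
      intro x hx
      obtain ⟨a, ha, b, hb, rfl⟩ :=
        Subgroup.mem_sup_of_normal_right.1 ((sup_le hP'le le_sup_right : R ≤ H ⊔ M) hx)
      have haR : a ∈ R := by
        have := R.mul_mem hx (R.inv_mem ((le_sup_right : M ≤ R) hb))
        rwa [mul_inv_cancel_right] at this
      exact Subgroup.mul_mem_sup ⟨ha, haR⟩ hb
    have hc1 := isComplement'_subgroupOf (IsPiNumber.coprime hP'π hMπ).symm (le_of_eq hR)
      le_sup_right le_sup_left
    have hc2 := isComplement'_subgroupOf (IsPiNumber.coprime
      (IsPiNumber.of_dvd hH.1 (Subgroup.card_dvd_of_le inf_le_left)) hMπ).symm hRle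
      le_sup_right inf_le_right
    have hMR : (Nat.card (M.subgroupOf R)).Coprime (M.subgroupOf R).index := by
      rw [hc1.symm.index_eq_card]
      exact ((IsPiNumber.coprime hP'π hMπ).symm.coprime_dvd_left
        (Subgroup.card_comap_dvd_of_injective M R.subtype R.subtype_injective)).coprime_dvd_right
        (Subgroup.card_comap_dvd_of_injective P' R.subtype R.subtype_injective)
    have : IsMulCommutative (M.subgroupOf R) :=
      ⟨⟨fun a b => Subtype.ext (Subtype.ext (congrArg (fun x : M => (x : G))
        (hMc.is_comm.comm (⟨a.1.1, a.2⟩ : M) ⟨b.1.1, b.2⟩)))⟩⟩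
    obtain ⟨r, hr⟩ := exists_conj_of_isComplement' hMR hc1 hc2
    refine ⟨r * g, fun x hx => ?_⟩
    have hxP : g * x * g⁻¹ ∈ P' := ⟨x, hx, rfl⟩
    have := (hr ⟨g * x * g⁻¹, (le_sup_left : P' ≤ R) hxP⟩ hxP).1
    simpa [mul_assoc] using this

theorem IsHall.nonempty_mulEquiv [Finite G] [Group.IsSolvable G] {A B : Subgroup G}
    (hA : IsHall π A) (hB : IsHall π B) : Nonempty (A ≃* B) := by
  obtain ⟨g, hg⟩ := hB.exists_conj_mem hA.1
  have h : A.map (MulAut.conj g).toMonoidHom = B := by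
    refine Subgroup.eq_of_le_of_card_ge ?_ ?_
    · rintro _ ⟨x, hx, rfl⟩
      exact hg x hx
    · rw [Subgroup.card_map_of_injective (MulAut.conj g).injective, hA.card_eq hB]
  exact ⟨(A.equivMapOfInjective _ (MulAut.conj g).injective).trans (MulEquiv.subgroupCongr h)⟩

end Hall

/-! ### Symmetry between π and π' -/

section Swap

variable {π : Set Nat.Primes} {G : Type*} [Group G]

theorem IsCon.compl (h : IsCon π G) : IsCon πᶜ G := fun A B hA hB => by
  rw [mul_comm]
  exact h B A (by rwa [compl_compl] at hB) hA

theorem IsConStar.compl (h : IsConStar π G) : IsConStar πᶜ G := fun A B hA hB => by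
  rw [mul_comm]
  exact (h B A (by rwa [compl_compl] at hB) hA).imp id
    fun ⟨e⟩ => ⟨e.trans MulEquiv.prodComm⟩

theorem IsSCon.compl (h : IsSCon π G) : IsSCon πᶜ G := by
  refine ⟨h.1.compl, fun A B hA hB M _ hM hp => ?_, fun A B hA hB M _ hM hp => ?_⟩
  · rw [mul_comm]
    exact h.2.2 B A (by rwa [compl_compl] at hB) hA M hM hp
  · rw [mul_comm]
    obtain ⟨p, hp, hMp⟩ := hp
    exact h.2.1 B A (by rwa [compl_compl] at hB) hA M hM ⟨p, not_not.1 hp, hMp⟩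

end Swap

/-! ### Irreducible characters of degree one -/

section Irr

variable {H : Type*} [Group H]

/-- χ(1) = 1 means the representation has dimension one, so its operators are scalars and commute.
-/
theorem map_commutatorElement_of_mem_Irr {χ : H → ℂ} (hχ : χ ∈ Irr H) (h1 : χ 1 = 1) (x y : H) :
    χ ⁅x, y⁆ = 1 := by
  obtain ⟨n, ρ, -, rfl⟩ := hχ
  have hd : Module.finrank ℂ (Fin n → ℂ) = 1 := by
    have := Representation.char_one ρ
    rw [h1] at this
    exact_mod_cast this.symm
  have hcomm : Commute (ρ y) (ρ x⁻¹) := by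
    obtain ⟨c, hc, -⟩ := LinearMap.existsUnique_eq_smul_id_of_finrank_eq_one hd (ρ y)
    rw [hc]
    exact (Commute.one_left _).smul_left c
  have : ρ ⁅x, y⁆ = 1 := by
    rw [commutatorElement_def, map_mul, map_mul, map_mul, mul_assoc (ρ x), hcomm.eq, ← mul_assoc,
      ← map_mul, mul_inv_cancel, map_one, one_mul, ← map_mul, mul_inv_cancel, map_one]
  rw [← h1, Representation.character, Representation.character, this, map_one ρ]

theorem addChar_mem_Irr (ψ : AddChar (Additive H) ℂ) :
    (fun x : H => ψ (Additive.ofMul x)) ∈ Irr H := by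
  let ρ : Representation ℂ H (Fin 1 → ℂ) :=
    { toFun := fun x => ψ (Additive.ofMul x) • 1
      map_one' := by simp
      map_mul' := fun x y => by
        rw [ofMul_mul, AddChar.map_add_eq_mul, smul_mul_smul_comm, one_mul] }
  refine ⟨1, ρ, ?_, ?_⟩
  · have hs : IsSimpleOrder (Submodule ℂ (Fin 1 → ℂ)) := by
      rw [← isSimpleModule_iff, isSimpleModule_iff_finrank_eq_one]
      simp
    have : Nontrivial (Subrepresentation ρ) := by
      refine ⟨⊥, ⊤, fun h => ?_⟩
      have := congrArg Subrepresentation.toSubmodule h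
      exact bot_ne_top this
    refine ⟨fun a => ?_⟩
    exact (eq_bot_or_eq_top a.toSubmodule).imp
      (fun h => Subrepresentation.toSubmodule_injective h)
      (fun h => Subrepresentation.toSubmodule_injective h)
  · ext x
    change LinearMap.trace ℂ (Fin 1 → ℂ) (ψ (Additive.ofMul x) • 1) = _
    rw [map_smul, LinearMap.trace_one]
    simp

end Irr

/-! ### The bound for an invariant linear character -/

section LocalBound

variable {π : Set Nat.Primes} {H : Type*} [Group H]

theorem nonempty_mulEquiv_map_of_disjoint {Q : Type*} [Group Q] (f : H →* Q) {B : Subgroup H}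
    (h : Disjoint f.ker B) : Nonempty (B ≃* B.map f) := by
  refine ⟨MulEquiv.ofBijective (f.subgroupMap B) ⟨?_, f.subgroupMap_surjective B⟩⟩
  rw [injective_iff_map_eq_one]
  intro x hx
  rw [Subtype.ext_iff] at hx
  exact Subtype.ext (Subgroup.disjoint_def.1 h (MonoidHom.mem_ker.2 hx) x.2)

theorem ccl_map_of_disjoint {Q : Type*} [Group Q] (f : H →* Q) {B : Subgroup H}
    (h : Disjoint f.ker B) : ccl (B.map f) = ccl B :=
  (nonempty_mulEquiv_map_of_disjoint f h).elim fun e => (ccl_congr e).symm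

theorem map_mk'_top (N : Subgroup H) [N.Normal] :
    (⊤ : Subgroup H).map (QuotientGroup.mk' N) = ⊤ :=
  Subgroup.map_top_of_surjective _ (QuotientGroup.mk'_surjective N)

theorem IsHall.disjoint_of_le {N A B : Subgroup H} (hA : IsHall π A) (hB : IsHall πᶜ B)
    (hN : N ≤ A) : Disjoint N B :=
  (Subgroup.disjoint_of_coprime_natCard (IsPiNumber.coprime hA.1 hB.1)).mono_left hN

variable [Finite H]

/-- The bound for the contribution of an invariant linear character to the class number. -/
def CommSumBound (A B : Subgroup H) (φ : H → ℂ) : Prop :=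
  ∃ g a : ℝ, commSum ⊤ φ = g ∧ commSum A φ = a ∧ 0 < a ∧ g ≤ a * (Nat.card B * ccl B)

/-- Under `hc` the sum agrees with that of the indicator of `N`, which counts pairs commuting modulo
`N`. As `B` meets `N` trivially, it embeds in the quotient as a Hall subgroup. -/
theorem commSumBound_of_isCon {N A B : Subgroup H} [N.Normal] (hA : IsHall π A)
    (hB : IsHall πᶜ B) (hN : N ≤ A) {φ : H → ℂ} (hφ : IsLinearOn N φ)
    (hc : ∀ x y : H, ⁅x, y⁆ ∈ N → φ ⁅x, y⁆ = 1) (hcon : IsCon π (H ⧸ N)) : CommSumBound A B φ := by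
  have hX : ∀ X : Subgroup H, N ≤ X → commSum X φ =
      (Nat.card N * Nat.card X * ccl (X.map (QuotientGroup.mk' N)) : ℝ) := by
    intro X hX
    push_cast
    rw [← commSum_indicator N X hX, commSum, commSum]
    refine finsum_congr fun p => ?_
    by_cases hp : ⁅(p.1 : H), (p.2 : H)⁆ ∈ N
    · simp [hp, hc _ _ hp]
    · simp [hp, hφ.eq_zero _ hp]
  refine ⟨_, _, hX ⊤ le_top, hX A hN, ?_, ?_⟩
  · have h1 : 0 < Nat.card N := Nat.card_pos
    have h2 : 0 < Nat.card A := Nat.card_pos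
    have h3 := ccl_pos (A.map (QuotientGroup.mk' N))
    positivity
  · have h1 := hcon _ _ (hA.map_of_surjective _ (QuotientGroup.mk'_surjective N))
      (hB.map_of_surjective _ (QuotientGroup.mk'_surjective N))
    rw [ccl_map_of_disjoint (B := B) _ (by simpa using hA.disjoint_of_le hB hN)] at h1
    rw [map_mk'_top, ccl_top, Subgroup.card_top, ← hA.card_mul_card hB]
    have h2 : (ccl (H ⧸ N) : ℝ) ≤ ccl (A.map (QuotientGroup.mk' N)) * ccl B := by exact_mod_cast h1
    calc _ = (Nat.card N * Nat.card A * Nat.card B : ℝ) * ccl (H ⧸ N) := by push_cast; ring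
      _ ≤ (Nat.card N * Nat.card A * Nat.card B : ℝ) *
          (ccl (A.map (QuotientGroup.mk' N)) * ccl B) := by gcongr
      _ = _ := by ring

theorem commSumBound_of_isSCon_of_central {M A B : Subgroup H} [M.Normal] (hA : IsHall π A)
    (hB : IsHall πᶜ B) (hM : M ≤ A) (hMc : M ≤ Subgroup.center H) {p : Nat.Primes}
    (hMp : Nat.card M = p) {φ : H → ℂ} (hφ : IsLinearOn M φ) (hne : ∃ m ∈ M, φ m ≠ 1)
    (hcon : IsSCon π H) : CommSumBound A B φ := by
  have hp1 : (1 : ℝ) < p := by exact_mod_cast p.2.one_lt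
  have hp0 : (0 : ℝ) < p - 1 := by linarith
  have hX : ∀ X : Subgroup H, M ≤ X → commSum X φ =
      (p * Nat.card X * (ccl X - ccl (X.map (QuotientGroup.mk' M))) / (p - 1) : ℝ) := by
    intro X hX
    have h0 : ((p : ℕ) - 1 : ℂ) ≠ 0 := by exact_mod_cast hp0.ne'
    have := commSum_of_card_prime p.2 M hMc hMp hφ hne hX
    push_cast
    rw [eq_div_iff h0, mul_comm, this]
  refine ⟨_, _, hX ⊤ le_top, hX A hM, ?_, ?_⟩
  · have h2 : 0 < Nat.card A := Nat.card_pos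
    have hM1 : M ≠ ⊥ := fun h => p.2.ne_one (by rw [← hMp, h, Subgroup.card_bot])
    have h3 : (0 : ℝ) < ccl A - ccl (A.map (QuotientGroup.mk' M)) := by
      rw [sub_pos]
      exact_mod_cast ccl_map_lt M hM1 A hM
    positivity
  · have hpπ : p ∈ π := hA.1 p (hMp ▸ Subgroup.card_dvd_of_le hM)
    have h1 := hcon.2.1 A B hA hB M hMc ⟨p, hpπ, hMp⟩
    rw [ccl_quotient_subgroupOf] at h1
    have h2 : (ccl H - ccl (H ⧸ M) : ℝ) ≤
        (ccl A - ccl (A.map (QuotientGroup.mk' M))) * ccl B := by exact_mod_cast h1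
    rw [map_mk'_top, ccl_top, ccl_top, Subgroup.card_top, ← hA.card_mul_card hB]
    calc _ = (p * Nat.card A * Nat.card B / (p - 1) : ℝ) * (ccl H - ccl (H ⧸ M)) := by
          push_cast; ring
      _ ≤ (p * Nat.card A * Nat.card B / (p - 1) : ℝ) *
          ((ccl A - ccl (A.map (QuotientGroup.mk' M))) * ccl B) := by gcongr
      _ = _ := by ring

/-- Pulling back multiplies both sums by |K|², and `B` is isomorphic to its image, so the inequality
is unchanged. -/
theorem CommSumBound.comp {K A B : Subgroup H} [K.Normal] (hKA : K ≤ A) (hKB : Disjoint K B)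
    {φ : H ⧸ K → ℂ} (h : CommSumBound (A.map (QuotientGroup.mk' K))
      (B.map (QuotientGroup.mk' K)) φ) :
    CommSumBound A B (fun x => φ (x : H ⧸ K)) := by
  obtain ⟨g, a, hg, ha, ha0, hle⟩ := h
  have hd : Disjoint (QuotientGroup.mk' K).ker B := by simpa using hKB
  have h1 := commSum_comp (QuotientGroup.mk' K) ⊤ le_top φ
  have h2 := commSum_comp (QuotientGroup.mk' K) A (by simpa using hKA) φ
  rw [map_mk'_top, hg] at h1
  rw [ha] at h2
  have hB : Nat.card (B.map (QuotientGroup.mk' K)) = Nat.card B :=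
    (nonempty_mulEquiv_map_of_disjoint _ hd).elim fun e => (Nat.card_congr e.toEquiv).symm
  rw [hB, ccl_map_of_disjoint _ hd] at hle
  have hk : 0 < Nat.card (QuotientGroup.mk' K).ker := Nat.card_pos
  refine ⟨(Nat.card (QuotientGroup.mk' K).ker : ℝ) ^ 2 * g,
    (Nat.card (QuotientGroup.mk' K).ker : ℝ) ^ 2 * a, ?_, ?_, by positivity, ?_⟩
  · push_cast
    exact h1
  · push_cast
    exact h2
  · rw [mul_assoc]
    gcongr

theorem commSumBound_of_isSCon {N K A B : Subgroup H} [N.Normal] [K.Normal] (hA : IsHall π A)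
    (hB : IsHall πᶜ B) (hN : N ≤ A) {p : Nat.Primes} (hp : ∀ x ∈ N, x ^ (p : ℕ) = 1)
    {φ : H → ℂ} (hφ : IsLinearOn N φ) (hinv : ∀ g, ∀ n ∈ N, φ (g * n * g⁻¹) = φ n)
    (hne : ∃ m ∈ N, φ m ≠ 1) (hK : ∀ x, x ∈ K ↔ x ∈ N ∧ φ x = 1) (hcon : IsSCon π (H ⧸ K)) :
    CommSumBound A B φ := by
  have hKN : K ≤ N := fun x hx => ((hK x).1 hx).1
  -- φ is constant on cosets of its kernel `K`, so any representative gives the induced function.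
  let φ' : H ⧸ K → ℂ := fun q => φ q.out
  have hφ' : ∀ x : H, φ' (x : H ⧸ K) = φ x := by
    intro x
    obtain ⟨k, hk⟩ := QuotientGroup.mk_out_eq_mul K x
    have hk2 := (hK k).1 k.2
    simp only [φ', hk]
    rw [hφ.map_mul_right hk2.1, hk2.2, one_mul]
  set M := N.map (QuotientGroup.mk' K) with hM
  have hmem : ∀ x : H, (x : H ⧸ K) ∈ M ↔ x ∈ N := by
    intro x
    refine ⟨?_, fun h => ⟨x, h, rfl⟩⟩
    rintro ⟨y, hy, hyx⟩
    rw [← QuotientGroup.mk'_apply, QuotientGroup.mk'_eq_mk'] at hyx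
    obtain ⟨z, hz, rfl⟩ := hyx
    exact N.mul_mem hy (hKN hz)
  have hMn : M.Normal := Subgroup.Normal.map ‹_› _ (QuotientGroup.mk'_surjective K)
  have hlin : IsLinearOn M φ' :=
    { map_one := by rw [← QuotientGroup.mk_one, hφ', hφ.map_one]
      map_mul := by
        rintro _ ⟨x, hx, rfl⟩ _ ⟨y, hy, rfl⟩
        simp only [QuotientGroup.mk'_apply]
        rw [← QuotientGroup.mk_mul, hφ', hφ', hφ', hφ.map_mul x hx y hy]
      eq_zero := by
        intro q hq
        obtain ⟨x, rfl⟩ := QuotientGroup.mk_surjective q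
        rw [hφ', hφ.eq_zero x fun h => hq ((hmem x).2 h)] }
  have hinj : ∀ q ∈ M, φ' q = 1 → q = 1 := by
    rintro _ ⟨x, hx, rfl⟩ h
    rw [QuotientGroup.mk'_apply, hφ'] at h
    exact (QuotientGroup.eq_one_iff x).2 ((hK x).2 ⟨hx, h⟩)
  -- Invariance of φ gives φ([g, n]) = 1, so [g, n] lies in `K`.
  have hMc : M ≤ Subgroup.center (H ⧸ K) := by
    rintro _ ⟨n, hn, rfl⟩
    rw [Subgroup.mem_center_iff]
    intro q
    obtain ⟨g, rfl⟩ := QuotientGroup.mk_surjective q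
    rw [QuotientGroup.mk'_apply, ← commutatorElement_eq_one_iff_mul_comm]
    have hg : g * n * g⁻¹ ∈ N := Subgroup.Normal.conj_mem ‹_› n hn g
    refine hinj ((⁅g, n⁆ : H) : H ⧸ K) ((hmem _).2 ?_) ?_
    · rw [commutatorElement_def]
      exact N.mul_mem hg (N.inv_mem hn)
    · rw [hφ', commutatorElement_def, hφ.map_mul_left hg, hinv g n hn, hφ.mul_map_inv hn]
  -- `M` embeds in the multiplicative monoid of ℂ, so it is cyclic; it has exponent dividing `p` and
  -- is nontrivial.
  have hMp : Nat.card M = p := by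
    let f : M →* ℂ :=
      { toFun := fun m => φ' m
        map_one' := hlin.map_one
        map_mul' := fun a b => hlin.map_mul a a.2 b b.2 }
    have hf : Function.Injective f :=
      (injective_iff_map_eq_one f).2 fun a ha => Subtype.ext (hinj a a.2 ha)
    have := isCyclic_of_injective_ringHom f hf
    obtain ⟨c, hc⟩ := IsCyclic.exists_generator (α := M)
    have hcp : c ^ (p : ℕ) = 1 := by
      obtain ⟨x, hx, hxc⟩ := c.2
      refine Subtype.ext ?_
      rw [Subgroup.coe_pow, ← hxc, ← map_pow, hp x hx, map_one, Subgroup.coe_one]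
    rw [← orderOf_eq_card_of_forall_mem_zpowers hc]
    refine ((Nat.dvd_prime p.2).1 (orderOf_dvd_of_pow_eq_one hcp)).resolve_left fun h1 => ?_
    rw [orderOf_eq_one_iff] at h1
    obtain ⟨m, hm, hm1⟩ := hne
    have h2 := hc ⟨(m : H ⧸ K), (hmem m).2 hm⟩
    rw [h1, Subgroup.zpowers_one_eq_bot, Subgroup.mem_bot] at h2
    apply hm1
    rw [← hφ', ← hlin.map_one]
    exact congrArg (fun z : M => φ' z) h2
  have hne' : ∃ m ∈ M, φ' m ≠ 1 := by
    obtain ⟨m, hm, hm1⟩ := hne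
    exact ⟨m, (hmem m).2 hm, by rwa [hφ']⟩
  have hb := commSumBound_of_isSCon_of_central
    (hA.map_of_surjective _ (QuotientGroup.mk'_surjective K))
    (hB.map_of_surjective _ (QuotientGroup.mk'_surjective K)) (Subgroup.map_mono hN) hMc hMp
    hlin hne' hcon
  have := hb.comp (hKN.trans hN) ((hA.disjoint_of_le hB hN).mono_left hKN)
  simpa only [hφ'] using this

end LocalBound

/-! ### The contribution of one character through its stabiliser -/

section Stabiliser

variable {G : Type*} [Group G] {N : Subgroup G} [N.Normal]

theorem mem_stab_charExt (ψ : AddChar (Additive N) ℂ) (g : G) :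
    g ∈ stab N (fun n => ψ (Additive.ofMul n)) ↔
      ∀ n ∈ N, charExt N ψ (g * n * g⁻¹) = charExt N ψ n := by
  rw [mem_stab]
  refine ⟨fun h n hn => ?_, fun h k => ?_⟩
  · have := h ⟨n, hn⟩
    rw [← charExt_coe, ← charExt_coe] at this
    simpa using this
  · rw [← charExt_coe, ← charExt_coe]
    simpa using h k k.2

theorem mem_kerInStab_charExt (hN : IsElementaryAbelian N) (ψ : AddChar (Additive N) ℂ)
    (x : stab N (fun n => ψ (Additive.ofMul n))) :
    x ∈ kerInStab N (fun n => ψ (Additive.ofMul n)) ↔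
      (x : G) ∈ N ∧ charExt N ψ x = 1 := by
  rw [kerInStab, Subgroup.mem_subgroupOf, Subgroup.mem_map]
  constructor
  · rintro ⟨k, hk, hkx⟩
    rw [mem_charKer_iff N hN (addChar_mem_Irr ψ), ofMul_one, AddChar.map_zero_eq_one] at hk
    rw [← hkx]
    exact ⟨k.2, by rw [← hk]; exact charExt_coe ψ k⟩
  · rintro ⟨hx, hx1⟩
    refine ⟨⟨x, hx⟩, ?_, rfl⟩
    rw [mem_charKer_iff N hN (addChar_mem_Irr ψ), ofMul_one, AddChar.map_zero_eq_one, ← hx1]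
    exact (charExt_coe ψ ⟨x, hx⟩).symm

variable [Finite G] {π : Set Nat.Primes}

theorem commSumBound_stab (hN : IsElementaryAbelian N)
    (hcon : ∀ ν ∈ Irr N, IsCon π (stab N ν ⧸ N.subgroupOf (stab N ν)))
    (h : (∀ (ν : N → ℂ) (hν : ν ∈ Irr N), ExtendsToStab N ν hν) ∨
      (∀ ν ∈ Irr N, IsSCon π (stab N ν ⧸ kerInStab N ν)))
    {A : Subgroup G} (hNA : N ≤ A) (hbal : ∀ ν ∈ Irr N, IsHall π (A.subgroupOf (stab N ν)))
    (ψ : AddChar (Additive N) ℂ)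
    {C : Subgroup (stab N (fun n => ψ (Additive.ofMul n)))} (hC : IsHall πᶜ C) :
    CommSumBound (A.subgroupOf (stab N (fun n => ψ (Additive.ofMul n)))) C
      (fun x => charExt N ψ x) := by
  set ν : N → ℂ := fun n => ψ (Additive.ofMul n) with hν
  have hνI : ν ∈ Irr N := addChar_mem_Irr ψ
  have hA := hbal ν hνI
  have hNA' : N.subgroupOf (stab N ν) ≤ A.subgroupOf (stab N ν) := fun x hx => hNA hx
  have hlin := isLinearOn_charExt_restrict (ψ := ψ) (stab N ν)
  -- The trivial character is set apart: its kernel is all of `N`, so the SCon argument has no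
  -- subgroup of order `p` to use.
  by_cases h1 : ∀ n ∈ N, charExt N ψ n = 1
  · exact commSumBound_of_isCon hA hC hNA' hlin (fun x y hxy => h1 _ hxy) (hcon ν hνI)
  rcases h with h | h
  · refine commSumBound_of_isCon hA hC hNA' hlin (fun x y hxy => ?_) (hcon ν hνI)
    obtain ⟨χ, hχ, hχν⟩ := h ν hνI
    have hχ1 : χ 1 = 1 := by
      have := hχν 1
      rw [map_one] at this
      exact this.trans (AddChar.map_zero_eq_one ψ)
    have h2 := map_commutatorElement_of_mem_Irr hχ hχ1 x y
    rw [← h2]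
    exact (charExt_coe ψ ⟨_, hxy⟩).trans (hχν ⟨_, hxy⟩).symm
  · obtain ⟨p, -, hp⟩ := id hN
    push Not at h1
    obtain ⟨m, hm, hm1⟩ := h1
    refine commSumBound_of_isSCon (p := p) hA hC hNA' (fun x hx => Subtype.ext (hp x hx)) hlin
      (fun g n hn => (mem_stab_charExt ψ g).1 g.2 n hn) ⟨⟨m, le_stab N hνI hm⟩, hm, hm1⟩
      (mem_kerInStab_charExt hN ψ) (h ν hνI)

/-- The contribution of one character of `N` to the class number. -/
theorem commSum_charExt_le [Group.IsSolvable G] (hN : IsElementaryAbelian N)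
    (hcon : ∀ ν ∈ Irr N, IsCon π (stab N ν ⧸ N.subgroupOf (stab N ν)))
    (h : (∀ (ν : N → ℂ) (hν : ν ∈ Irr N), ExtendsToStab N ν hν) ∨
      (∀ ν ∈ Irr N, IsSCon π (stab N ν ⧸ kerInStab N ν)))
    {A B : Subgroup G} (hNA : N ≤ A) (hB : IsHall πᶜ B)
    (hbal : ∀ ν ∈ Irr N, IsHall π (A.subgroupOf (stab N ν))) (ψ : AddChar (Additive N) ℂ) :
    ∃ g a : ℝ, commSum ⊤ (charExt N ψ) = g ∧ commSum A (charExt N ψ) = a ∧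
      g ≤ a * (Nat.card B * ccl B) ∧ (g = a * (Nat.card B * ccl B) →
        ∃ r : G, ∀ x ∈ B, r * x * r⁻¹ ∈ stab N (fun n => ψ (Additive.ofMul n))) := by
  set T := stab N (fun n => ψ (Additive.ofMul n)) with hT
  obtain ⟨C, hC⟩ := exists_isHall πᶜ T
  obtain ⟨g, a, hg, ha, ha0, hle⟩ := commSumBound_stab hN hcon h hNA hbal ψ hC
  have hred : ∀ X : Subgroup G, N ≤ X → commSum X (charExt N ψ) =
      commSum (X.subgroupOf T) (fun x => charExt N ψ x) := fun X hX => by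
    rw [commSum_subgroupOf, commSum_eq_commSum_inf (isLinearOn_charExt ψ) (mem_stab_charExt ψ) hX]
  have hCπ : IsPiNumber πᶜ (Nat.card (C.map T.subtype)) :=
    IsPiNumber.of_dvd hC.1 (Subgroup.card_map_dvd _ _)
  obtain ⟨r, hr⟩ := hB.exists_conj_mem hCπ
  let f : G →* G := (MulAut.conj r).toMonoidHom
  let D := (C.map T.subtype).map f
  have hDB : D ≤ B := by
    rintro _ ⟨x, hx, rfl⟩
    exact hr x hx
  let e : C ≃* D := (C.equivMapOfInjective _ T.subtype_injective).trans
    ((C.map T.subtype).equivMapOfInjective _ (MulAut.conj r).injective)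
  have hDc : Nat.card D * ccl D = Nat.card C * ccl C := by
    rw [ccl_congr e, Nat.card_congr e.toEquiv]
  refine ⟨g, a, ?_, ?_, ?_, fun heq => ?_⟩
  · rw [hred ⊤ le_top, Subgroup.top_subgroupOf, hg]
  · rw [hred A hNA, ha]
  · refine hle.trans (mul_le_mul_of_nonneg_left ?_ ha0.le)
    have := card_mul_ccl_le hDB
    rw [hDc] at this
    exact_mod_cast this
  -- Since a > 0, equality forces equal numbers of commuting pairs in `D` and `B`, hence D = B.
  · have hDeq : D = B := by
      by_contra hne
      have hlt := card_mul_ccl_lt (lt_of_le_of_ne hDB hne)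
      rw [hDc] at hlt
      have hlt' : (Nat.card C * ccl C : ℝ) < Nat.card B * ccl B := by exact_mod_cast hlt
      have := mul_lt_mul_of_pos_left hlt' ha0
      linarith
    refine ⟨r⁻¹, fun x hx => ?_⟩
    rw [← hDeq] at hx
    obtain ⟨_, ⟨y, hy, rfl⟩, rfl⟩ := hx
    have : r⁻¹ * (r * (y : G) * r⁻¹) * r⁻¹⁻¹ = y := by group
    change r⁻¹ * (r * (y : G) * r⁻¹) * r⁻¹⁻¹ ∈ T
    rw [this]
    exact y.2

end Stabiliser

/-! ### Recognising a direct product of Hall subgroups -/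

section DirectProducts

variable {π : Set Nat.Primes} {G : Type*} [Group G]

/-- The isomorphism need not carry `A` to the first factor, but the kernel of the projection to `B`
is a normal Hall π-subgroup, and such a subgroup is the only one. -/
theorem IsHall.normal_of_mulEquiv_prod [Finite G] {A B : Subgroup G} (hA : IsHall π A) (hB : IsHall πᶜ B)
    (e : G ≃* A × B) : A.Normal := by
  let f : G →* B := (MonoidHom.snd A B).comp e.toMonoidHom
  have hf : Function.Surjective f := fun b => ⟨e.symm (1, b), by simp [f]⟩
  have hind : f.ker.index = Nat.card B := by
    rw [Subgroup.index_ker, MonoidHom.range_eq_top.2 hf, Subgroup.card_top]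
  have hcard : Nat.card f.ker = Nat.card A := by
    have h1 := f.ker.card_mul_index
    rw [hind, ← hA.card_mul_card hB] at h1
    exact Nat.eq_of_mul_eq_mul_right Nat.card_pos h1
  have hker : IsHall π f.ker := by
    rw [isHall_iff, hcard, hind]
    exact ⟨hA.1, hB.1⟩
  rw [hker.eq_of_normal hA]
  infer_instance

theorem IsHall.nonempty_mulEquiv_prod [Finite G] {A B : Subgroup G} [A.Normal] [B.Normal]
    (hA : IsHall π A) (hB : IsHall πᶜ B) : Nonempty (G ≃* A × B) := by
  have hd : Disjoint A B := hA.disjoint_of_le hB le_rfl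
  have hc : ∀ (a : A) (b : B), Commute (A.subtype a) (B.subtype b) := fun a b =>
    Subgroup.commute_of_normal_of_disjoint A B ‹_› ‹_› hd a b a.2 b.2
  let f : A × B →* G := MonoidHom.noncommCoprod A.subtype B.subtype hc
  have hf : Function.Injective f := by
    rw [injective_iff_map_eq_one]
    rintro ⟨a, b⟩ hab
    have h1 : (a : G) * b = 1 := hab
    have h2 : (a : G) = (b : G)⁻¹ := eq_inv_of_mul_eq_one_left h1
    have h3 : (a : G) = 1 := Subgroup.disjoint_def.1 hd a.2 (h2 ▸ B.inv_mem b.2)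
    rw [h3, one_mul] at h1
    exact Prod.ext (Subtype.ext h3) (Subtype.ext h1)
  have hb : Function.Bijective f := (Nat.bijective_iff_injective_and_card f).2
    ⟨hf, by rw [Nat.card_prod, hA.card_mul_card hB]⟩
  exact ⟨(MulEquiv.ofBijective f hb).symm⟩

/-- A conjugate of b in `B` has the form cn with c in `B` and n in `N` commuting. Raising to the
power |B| gives n^|B| = 1, and coprimality with |N| gives n = 1. -/
theorem IsHall.normal_of_sup_normal {N A B : Subgroup G} [N.Normal] (hA : IsHall π A)
    (hB : IsHall πᶜ B) (hN : N ≤ A) (hsup : (B ⊔ N).Normal)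
    (hcomm : ∀ b ∈ B, ∀ n ∈ N, Commute b n) : B.Normal := by
  refine ⟨fun b hb g => ?_⟩
  obtain ⟨c, hc, n, hn, hcn⟩ := Subgroup.mem_sup_of_normal_right.1
    (hsup.conj_mem b ((le_sup_left : B ≤ B ⊔ N) hb) g)
  have hpow : ∀ x ∈ B, x ^ Nat.card B = 1 := fun x hx =>
    congrArg Subtype.val (pow_card_eq_one' (x := (⟨x, hx⟩ : B)))
  have hn1 : n ^ Nat.card B = 1 := by
    have h1 := congrArg (· ^ Nat.card B) hcn
    simpa [(hcomm c hc n hn).mul_pow, conj_pow, hpow c hc, hpow b hb] using h1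
  have hn2 : n ^ Nat.card N = 1 :=
    congrArg Subtype.val (pow_card_eq_one' (x := (⟨n, hn⟩ : N)))
  have hcop : (Nat.card B).Coprime (Nat.card N) :=
    (IsPiNumber.coprime (IsPiNumber.of_dvd hA.1 (Subgroup.card_dvd_of_le hN)) hB.1).symm
  have hn3 : n = 1 := by
    rw [← orderOf_eq_one_iff]
    exact Nat.eq_one_of_dvd_coprimes hcop (orderOf_dvd_of_pow_eq_one hn1)
      (orderOf_dvd_of_pow_eq_one hn2)
  rw [← hcn, hn3, mul_one]
  exact hc

end DirectProducts

/-! ### Summation over the characters of `N` and the equality case -/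

section Main

variable {G : Type*} [Group G] [Finite G] [Group.IsSolvable G] {π : Set Nat.Primes}
  {N : Subgroup G} [N.Normal]

theorem card_mul_ccl_eq_of_bound_eq (hN : IsElementaryAbelian N)
    (hcon : ∀ ν ∈ Irr N, IsCon π (stab N ν ⧸ N.subgroupOf (stab N ν)))
    (h : (∀ (ν : N → ℂ) (hν : ν ∈ Irr N), ExtendsToStab N ν hν) ∨
      (∀ ν ∈ Irr N, IsSCon π (stab N ν ⧸ kerInStab N ν)))
    {A B : Subgroup G} (hA : IsHall π A) (hNA : N ≤ A) (hB : IsHall πᶜ B)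
    (hbal : ∀ ν ∈ Irr N, IsHall π (A.subgroupOf (stab N ν))) :
    ccl G ≤ ccl A * ccl B ∧ (ccl G = ccl A * ccl B → ∀ ψ : AddChar (Additive N) ℂ,
      commSum ⊤ (charExt N ψ) = commSum A (charExt N ψ) * (Nat.card B * ccl B) ∧
      ∃ r : G, ∀ x ∈ B, r * x * r⁻¹ ∈ stab N (fun n => ψ (Additive.ofMul n))) := by
  have : IsMulCommutative N := by
    obtain ⟨p, hc, -⟩ := hN
    exact ⟨⟨fun a b => Subtype.ext (hc a a.2 b b.2)⟩⟩
  have : Finite (AddChar (Additive N) ℂ) := by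
    open scoped IsMulCommutative in infer_instance
  have := Fintype.ofFinite (AddChar (Additive N) ℂ)
  choose g a hg ha hle heq using commSum_charExt_le hN hcon h hNA hB hbal
  have hsg : (Nat.card N * (Nat.card G * ccl G) : ℝ) = ∑ ψ, g ψ := by
    have := card_mul_ccl_eq_sum N (⊤ : Subgroup G)
    simp_rw [hg, ccl_top, Subgroup.card_top] at this
    exact_mod_cast this
  have hsa : (Nat.card N * (Nat.card A * ccl A) : ℝ) = ∑ ψ, a ψ := by
    have := card_mul_ccl_eq_sum N A
    simp_rw [ha] at this
    exact_mod_cast this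
  have hpos : (0 : ℝ) < Nat.card N * Nat.card G := by
    have h1 : 0 < Nat.card N := Nat.card_pos
    have h2 : 0 < Nat.card G := Nat.card_pos
    positivity
  have hGAB : (Nat.card G : ℝ) = Nat.card A * Nat.card B := by
    exact_mod_cast (hA.card_mul_card hB).symm
  have hsum : ∑ ψ, a ψ * (Nat.card B * ccl B) =
      Nat.card N * Nat.card G * (ccl A * ccl B : ℝ) := by
    rw [← Finset.sum_mul, ← hsa, hGAB]
    ring
  have hsumg : ∑ ψ, g ψ = Nat.card N * Nat.card G * (ccl G : ℝ) := by
    rw [← hsg]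
    ring
  refine ⟨?_, fun hccl ψ => ?_⟩
  · have h1 := Finset.sum_le_sum fun ψ (_ : ψ ∈ Finset.univ) => hle ψ
    rw [hsum, hsumg] at h1
    exact_mod_cast le_of_mul_le_mul_left h1 hpos
  · have h1 : ∑ ψ, g ψ = ∑ ψ, a ψ * (Nat.card B * ccl B) := by
      rw [hsum, hsumg, hccl]
      push_cast
      rfl
    have h2 := (Finset.sum_eq_sum_iff_of_le fun ψ _ => hle ψ).1 h1 ψ (Finset.mem_univ ψ)
    refine ⟨?_, heq ψ h2⟩
    rw [hg, ha, h2]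
    push_cast
    rfl

theorem isCon_and_isConStar_of_balanced (hN : IsElementaryAbelian N)
    (hbal : ∃ A : Subgroup G, IsHall π A ∧ N ≤ A ∧
      ∀ ν ∈ Irr N, IsHall π (A.subgroupOf (stab N ν)))
    (hcon : ∀ ν ∈ Irr N, IsCon π (stab N ν ⧸ N.subgroupOf (stab N ν)))
    (h : (∀ (ν : N → ℂ) (hν : ν ∈ Irr N), ExtendsToStab N ν hν) ∨
      (∀ ν ∈ Irr N, IsSCon π (stab N ν ⧸ kerInStab N ν))) :
    IsCon π G ∧ (IsConStar π (G ⧸ N) → IsConStar π G) := by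
  obtain ⟨A₀, hA₀, hNA, hbal⟩ := hbal
  have hmain := fun (B : Subgroup G) (hB : IsHall πᶜ B) =>
    card_mul_ccl_eq_of_bound_eq hN hcon h hA₀ hNA hB hbal
  have hA : ∀ A : Subgroup G, IsHall π A → ccl A = ccl A₀ := fun A hA =>
    (hA.nonempty_mulEquiv hA₀).elim fun e => ccl_congr e
  refine ⟨fun A B hA' hB => hA A hA' ▸ (hmain B hB).1, fun hstar A B hA' hB => ?_⟩
  rw [hA A hA']
  obtain ⟨hle, heq⟩ := hmain B hB
  refine hle.lt_or_eq.imp id fun hccl => ?_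
  replace heq := heq hccl
  have hBN : Disjoint N B := hA₀.disjoint_of_le hB hNA
  have hd : Disjoint (QuotientGroup.mk' N).ker B := by simpa using hBN
  have hmk := QuotientGroup.mk'_surjective N
  have hcclN : ccl (G ⧸ N) =
      ccl (A₀.map (QuotientGroup.mk' N)) * ccl (B.map (QuotientGroup.mk' N)) := by
    -- The zero additive character is the trivial character of `N`, whose extension by zero is the
    -- indicator of `N`.
    have h0 := (heq 0).1
    have hχ : charExt N (0 : AddChar (Additive N) ℂ) = (N : Set G).indicator 1 := by
      ext x
      by_cases hx : x ∈ N <;> simp [charExt, hx]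
    rw [hχ, commSum_indicator N ⊤ le_top, commSum_indicator N A₀ hNA, map_mk'_top, ccl_top,
      Subgroup.card_top, ← hA₀.card_mul_card hB] at h0
    rw [ccl_map_of_disjoint _ hd]
    have h1 : Nat.card N * Nat.card A₀ * Nat.card B * ccl (G ⧸ N) =
        Nat.card N * Nat.card A₀ * Nat.card B *
          (ccl (A₀.map (QuotientGroup.mk' N)) * ccl B) := by
      have h2 : (Nat.card N * Nat.card A₀ * Nat.card B * ccl (G ⧸ N) : ℂ) =
        Nat.card N * Nat.card A₀ * Nat.card B *
          (ccl (A₀.map (QuotientGroup.mk' N)) * ccl B) := by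
        push_cast at h0
        linear_combination h0
      exact_mod_cast h2
    exact Nat.eq_of_mul_eq_mul_left
      (Nat.mul_pos (Nat.mul_pos Nat.card_pos Nat.card_pos) Nat.card_pos) h1
  have hA₀q := hA₀.map_of_surjective _ hmk
  have hBq := hB.map_of_surjective _ hmk
  obtain ⟨e⟩ := (hstar _ _ hA₀q hBq).resolve_left hcclN.not_lt
  have hAqn := hA₀q.normal_of_mulEquiv_prod hBq e
  have hBqn := hBq.normal_of_mulEquiv_prod hA₀q.compl_compl (e.trans MulEquiv.prodComm)
  have hA₀n : A₀.Normal := by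
    rw [← Subgroup.comap_map_eq_self (f := QuotientGroup.mk' N) (H := A₀) (by simpa using hNA)]
    exact hAqn.comap _
  have hsup : (B ⊔ N).Normal := by
    have := Subgroup.comap_map_eq (QuotientGroup.mk' N) B
    rw [QuotientGroup.ker_mk'] at this
    rw [← this]
    exact hBqn.comap _
  have : IsMulCommutative N := by
    obtain ⟨p, hc, -⟩ := hN
    exact ⟨⟨fun a b => Subtype.ext (hc a a.2 b b.2)⟩⟩
  have hBstab : ∀ ψ : AddChar (Additive N) ℂ, B ≤ stab N (fun n => ψ (Additive.ofMul n)) := by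
    intro ψ b hb
    obtain ⟨r, hr⟩ := (heq ψ).2
    have hb' : r⁻¹ * b * r⁻¹⁻¹ ∈ B ⊔ N := hsup.conj_mem b ((le_sup_left : B ≤ B ⊔ N) hb) r⁻¹
    obtain ⟨c, hc, n, hn, hcn⟩ := Subgroup.mem_sup_of_normal_right.1 hb'
    -- The first factor fixes ψ by the choice of r, and the second because it lies in `N`.
    have : b = r * c * r⁻¹ * (r * n * r⁻¹) := by
      calc b = r * (r⁻¹ * b * r⁻¹⁻¹) * r⁻¹ := by group
        _ = _ := by rw [← hcn]; group
    rw [this]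
    exact Subgroup.mul_mem _ (hr c hc)
      (le_stab N (addChar_mem_Irr ψ) (Subgroup.Normal.conj_mem ‹_› n hn r))
  have hcomm : ∀ b ∈ B, ∀ n ∈ N, Commute b n := by
    intro b hb n hn
    have h1 : b * n * b⁻¹ = n := charExt_eq_of_forall (Subgroup.Normal.conj_mem ‹_› n hn b) hn
      fun ψ => (mem_stab_charExt ψ b).1 (hBstab ψ hb) n hn
    exact mul_inv_eq_iff_eq_mul.1 h1
  have hBn := hA₀.normal_of_sup_normal hB hNA hsup hcomm
  rw [hA₀.eq_of_normal hA']
  exact hA₀.nonempty_mulEquiv_prod hB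

end Main

end HallConj

theorem theoremC {G : Type*} [Group G] [Finite G] [Group.IsSolvable G] (π : Set Nat.Primes)
    (N : Subgroup G) [N.Normal] (hN : IsElementaryAbelian N)
    (hbal : HasBalancedAction N π)
    (hcon : ∀ ν ∈ Irr N, IsCon π (stab N ν ⧸ N.subgroupOf (stab N ν)))
    (h : (∀ (ν : N → ℂ) (hν : ν ∈ Irr N), ExtendsToStab N ν hν) ∨
      (∀ ν ∈ Irr N, IsSCon π (stab N ν ⧸ kerInStab N ν))) :
    IsCon π G ∧ (IsConStar π (G ⧸ N) → IsConStar π G) := by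
  rcases hbal with hbal | hbal
  · exact isCon_and_isConStar_of_balanced hN hbal hcon h
  -- Every hypothesis and conclusion is symmetric under exchanging π and π', which reduces this case
  -- to `N` lying in the Hall π-subgroup.
  · obtain ⟨h1, h2⟩ := isCon_and_isConStar_of_balanced (π := πᶜ) hN hbal
      (fun ν hν => (hcon ν hν).compl) (h.imp id fun h ν hν => (h ν hν).compl)
    refine ⟨?_, fun hs => ?_⟩
    · have := h1.compl
      rwa [compl_compl] at this
    · have := (h2 hs.compl).compl
      rwa [compl_compl] at this
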